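/- **Theorem 8.2 (The four vertex theorem for normed planes).** Let $(X,\|\cdot\|)$ be a normed plane, that is, a two-dimensional real normed space, whose unit circle $S$ is a strictly convex curve of class $C^2$. Fix a determinant form $[\cdot,\cdot]$ (a non-zero alternating bilinear form) on $X$. Let $\gamma$ be a simple, closed, strictly convex curve in $X$, i.e. a regular $C^2$ curve $\gamma:\mathbb R\to X$ of some period $c>0$, injective on $[0,c)$, whose image is the boundary of a compact convex region with no segment in its boundary. Then each of the Minkowski, normal, circular and arc-length curvature functions of $\gamma$ has at least four local extrema (not necessarily strict), i.e. at least four parameters in $[0,c)$ at which it has a local maximum or minimum. Here $s$ is the arc length of $\gamma$, $T=d\gamma/ds$ is the unit tangent, and $n$ is the right normal field: $\|T\|\le\|T+rn\|$ for all $r\in\mathbb R$, and $[T,n]=1$. Let $\varphi$ and $\bar\varphi$ be positively oriented parametrizations of $S$ by twice the area of sectors (i.e. $[\varphi,\varphi']=1$) and by arc length, respectively. Let $\psi$ be a parametrization by twice the area of sectors of the unit circle $\{x:\|x\|_a=1\}$ of the anti-norm $\|x\|_a=\sup\{|[x,y]|:y\in S\}$. All three are defined on $\mathbb R$. The curvatures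 are * Minkowski: $k_m=du/ds$, where $T=\varphi\circ u$; * normal: $k_n=dv/ds$, where $n=\psi\circ v$; * circular: $k_c=dt/ds$, where $T=\bar\varphi'\circ t$; * arc-length: $k_l=dt/ds$, where $T=\bar\varphi\circ t$; with $u,v,t$ of class $C^1$. The functions $k_m,k_n,k_l$ always exist. The function $k_c$ exists whenever the curvature of $S$ vanishes nowhere, i.e. $[\sigma',\sigma'']\neq0$ for a regular $C^2$ parametrization $\sigma$ of $S$. Without this condition, the claim on $k_c$ holds whenever $t$ can be chosen of class $C^1$. -/

import Mathlib

open Set Metric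

/-- A simple closed curve of class `C²` in `X`: a regular parametrization `γ`, extended to `ℝ` with
period `c`, which is injective on one period. -/
structure IsSimpleClosedCurve {X : Type*} [NormedAddCommGroup X] [NormedSpace ℝ X]
    (γ : ℝ → X) (c : ℝ) : Prop where
  period_pos : 0 < c
  contDiff : ContDiff ℝ 2 γ
  periodic : Function.Periodic γ c
  injOn : InjOn γ (Ico 0 c)
  regular : ∀ τ, deriv γ τ ≠ 0

/-- A simple closed `C²` curve is strictly convex if it is the boundary of a compact convex region
whose boundary contains no segment. -/
structure IsStrictlyConvexCurve {X : Type*} [NormedAddCommGroup X] [NormedSpace ℝ X]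
    (γ : ℝ → X) (c : ℝ) : Prop extends IsSimpleClosedCurve γ c where
  bounds : ∃ K : Set X, IsCompact K ∧ StrictConvex ℝ K ∧ frontier K = range γ

/-- Birkhoff orthogonality `x ⊣ y`. -/
def BirkhoffOrthogonal {X : Type*} [NormedAddCommGroup X] [NormedSpace ℝ X] (x y : X) : Prop :=
  ∀ t : ℝ, ‖x‖ ≤ ‖x + t • y‖

/-- The anti-norm of `x` with respect to the determinant form `ω`: the supremum of `|ω x y|` over
the unit circle. -/
noncomputable def antiNorm {X : Type*} [NormedAddCommGroup X] [NormedSpace ℝ X]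
    (ω : LinearMap.BilinForm ℝ X) (x : X) : ℝ :=
  sSup ((fun y => |ω x y|) '' sphere (0 : X) 1)

/-- A parametrization of a set by twice the area of sectors: twice the (signed) area swept by `φ`
between the parameters `a` and `b` is `∫ t in a..b, ω (φ t) (φ' t)`, so it equals `b - a` for all
`a` and `b` exactly when the integrand is `1`. It is positively oriented, and it is
defined on all of `ℝ` (it runs around a closed curve periodically). -/
structure IsSectorAreaParam {X : Type*} [NormedAddCommGroup X] [NormedSpace ℝ X]
    (ω : LinearMap.BilinForm ℝ X) (φ : ℝ → X) (C : Set X) : Prop where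
  contDiff : ContDiff ℝ 1 φ
  mem : ∀ u, φ u ∈ C
  area : ∀ u, ω (φ u) (deriv φ u) = 1

/-- A positively oriented parametrization of a set by arc length in the norm, defined on
all of `ℝ` (it runs around a closed curve periodically). -/
structure IsArcLengthParam {X : Type*} [NormedAddCommGroup X] [NormedSpace ℝ X]
    (ω : LinearMap.BilinForm ℝ X) (φ : ℝ → X) (C : Set X) : Prop where
  contDiff : ContDiff ℝ 1 φ
  mem : ∀ t, φ t ∈ C
  unit_speed : ∀ t, ‖deriv φ t‖ = 1
  oriented : ∀ t, 0 < ω (φ t) (deriv φ t)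

/-- The unit tangent field, that is the derivative of `γ` with respect to arc length. -/
noncomputable def unitTangent {X : Type*} [NormedAddCommGroup X] [NormedSpace ℝ X]
    (γ : ℝ → X) (τ : ℝ) : X :=
  ‖deriv γ τ‖⁻¹ • deriv γ τ

/-- `f` is of class `C¹` and `k` is its derivative with respect to the arc length `s` of `γ`,
where `ds = ‖γ'(τ)‖ dτ`. -/
def IsArcLengthDeriv {X : Type*} [NormedAddCommGroup X] [NormedSpace ℝ X]
    (γ : ℝ → X) (f k : ℝ → ℝ) : Prop :=
  ContDiff ℝ 1 f ∧ ∀ τ, deriv f τ = k τ * ‖deriv γ τ‖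

/-- `n` is the right normal field of `γ`: `γ' ⊣ n` and `ω T n = 1`, with `T` the unit tangent. -/
def IsRightNormalField {X : Type*} [NormedAddCommGroup X] [NormedSpace ℝ X]
    (ω : LinearMap.BilinForm ℝ X) (γ n : ℝ → X) : Prop :=
  ∀ τ, BirkhoffOrthogonal (unitTangent γ τ) (n τ) ∧ ω (unitTangent γ τ) (n τ) = 1

/-- `k` is the Minkowski curvature function of `γ`: `T = φ ∘ u` with `φ` the unit circle
parametrized by twice the area of sectors, and `k = du/ds`. -/
def IsMinkowskiCurvature {X : Type*} [NormedAddCommGroup X] [NormedSpace ℝ X]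
    (ω : LinearMap.BilinForm ℝ X) (γ : ℝ → X) (k : ℝ → ℝ) : Prop :=
  ∃ (φ : ℝ → X) (u : ℝ → ℝ), IsSectorAreaParam ω φ (sphere 0 1) ∧
    (∀ τ, unitTangent γ τ = φ (u τ)) ∧ IsArcLengthDeriv γ u k

/-- `k` is the normal curvature function of `γ`: `n = ψ ∘ v` with `n` the right normal field, `ψ`
the unit circle of the anti-norm parametrized by twice the area of sectors, and `k = dv/ds`. -/
def IsNormalCurvature {X : Type*} [NormedAddCommGroup X] [NormedSpace ℝ X]
    (ω : LinearMap.BilinForm ℝ X) (γ : ℝ → X) (k : ℝ → ℝ) : Prop :=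
  ∃ (n ψ : ℝ → X) (v : ℝ → ℝ), IsRightNormalField ω γ n ∧
    IsSectorAreaParam ω ψ {x | antiNorm ω x = 1} ∧
    (∀ τ, n τ = ψ (v τ)) ∧ IsArcLengthDeriv γ v k

/-- `k` is the circular curvature function of `γ`: `T = φ' ∘ t` with `φ` the unit circle
parametrized by arc length, and `k = dt/ds`. -/
def IsCircularCurvature {X : Type*} [NormedAddCommGroup X] [NormedSpace ℝ X]
    (ω : LinearMap.BilinForm ℝ X) (γ : ℝ → X) (k : ℝ → ℝ) : Prop :=
  ∃ (φ : ℝ → X) (t : ℝ → ℝ), IsArcLengthParam ω φ (sphere 0 1) ∧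
    (∀ τ, unitTangent γ τ = deriv φ (t τ)) ∧ IsArcLengthDeriv γ t k

/-- `k` is the arc-length curvature function of `γ`: `T = φ ∘ t` with `φ` the unit circle
parametrized by arc length, and `k = dt/ds`. -/
def IsArcLengthCurvature {X : Type*} [NormedAddCommGroup X] [NormedSpace ℝ X]
    (ω : LinearMap.BilinForm ℝ X) (γ : ℝ → X) (k : ℝ → ℝ) : Prop :=
  ∃ (φ : ℝ → X) (t : ℝ → ℝ), IsArcLengthParam ω φ (sphere 0 1) ∧
    (∀ τ, unitTangent γ τ = φ (t τ)) ∧ IsArcLengthDeriv γ t k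

/-- At least four points of a closed curve of period `c` are local extrema of `k`. -/
def HasFourLocalExtrema (c : ℝ) (k : ℝ → ℝ) : Prop :=
  4 ≤ {τ | τ ∈ Ico 0 c ∧ IsLocalExtr k τ}.encard

/-!
Write `T`, `s` for the unit tangent and the arc length of `γ`. The four curvatures `k` have one
property in common: the vector-valued integral `∫ k T ds = ∫ k dγ` over one period vanishes, that
is, `k γ'` is the derivative of a periodic curve (`exists_periodic_primitive`).

* For `k_n`, this curve is `-n`: at `n = ψ(v)` the functional `ω T` is maximal on the anti-circle,
  so that `ψ'(v) = -T`. It closes up because the smooth unit circle has just one right normal at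
  each of its points.
* For `k_c`, it is `φ(t)`, the point of the unit circle where the tangent vector is `T`. It closes
  up because the unit circle is strictly convex.
* For `k_m` and `k_l`, it is the integral of `φ(u) du` along the unit circle, where `du` is the
  element of sector area or of arc length. It closes up because the circle is symmetric about the origin.

The classical argument then applies to any such density `k`
(`IsStrictlyConvexCurve.hasFourLocalExtrema`). With fewer than four local extrema, `k` is strictly
monotone on both arcs between a maximum `γ p` and a minimum `γ q`. Let `F` be the determinant
`ω (γ - γ p) (γ q - γ p)`, whose sign tells the sides of the chord. By strict convexity, `F` has
opposite signs on the two arcs, so "integrating by parts" gives `∫ k dF = -∫ F dk ≠ 0`, a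
contradiction. As `k` is only continuous, the integration by parts is replaced by a monotonicity
argument for `∫ k dF - k F` (`lt_of_hasDerivAt_mul_of_strictAntiOn`).

For existence, the unit circle is parametrized by the angle `α` of a linear coordinate `e : X ≃ ℂ`
(`polar`), which is as smooth as `σ`, and tangent angles are obtained by integrating `γ''/γ'` in `ℂ`
(`exists_angle`). The parametrizations by sector area and arc length are obtained from it by
`exists_reparametrization`. The same lemma applies to the anti-circle, parametrized by the right
normals of the unit circle, although this parametrization stops where the curvature of the unit
circle vanishes: its derivative is a multiple of the nowhere vanishing `-polar`.
-/

/-! ### Coordinates -/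

/-- `e` is a linear coordinate on the plane with values in `ℂ` in which `ω` is the standard
determinant. -/
def IsDetCoordinate {X : Type*} [NormedAddCommGroup X] [NormedSpace ℝ X]
    (ω : LinearMap.BilinForm ℝ X) (e : X ≃L[ℝ] ℂ) : Prop :=
  ∀ x y, ω x y = (e x).re * (e y).im - (e x).im * (e y).re

theorem exists_isDetCoordinate {X : Type*} [NormedAddCommGroup X] [NormedSpace ℝ X]
    (hX : Module.finrank ℝ X = 2) {ω : LinearMap.BilinForm ℝ X} (hω : ω.IsAlt) (hω0 : ω ≠ 0) :
    ∃ e : X ≃L[ℝ] ℂ, IsDetCoordinate ω e := by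
  have hfd : FiniteDimensional ℝ X := Module.finite_of_finrank_eq_succ hX
  let b := Module.finBasisOfFinrankEq ℝ X hX
  have hexp : ∀ x y,
      ω x y = (b.repr x 0 * b.repr y 1 - b.repr x 1 * b.repr y 0) * ω (b 0) (b 1) := by
    intro x y
    have h10 : ω (b 1) (b 0) = - ω (b 0) (b 1) :=
      (LinearMap.BilinForm.IsAlt.neg_eq hω (b 0) (b 1)).symm
    conv_lhs => rw [← b.sum_repr x, ← b.sum_repr y]
    simp only [Fin.sum_univ_two, map_add, map_smul, LinearMap.add_apply, LinearMap.smul_apply,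
      smul_eq_mul, hω (b 0), hω (b 1), h10]
    ring
  have hd : ω (b 0) (b 1) ≠ 0 := by
    intro h
    apply hω0
    ext x y
    rw [hexp, h]
    simp
  set d := ω (b 0) (b 1) with hd_def
  have hu : ∀ i : Fin 2, IsUnit ((![1, d⁻¹] : Fin 2 → ℝ) i) := by
    intro i
    fin_cases i <;> simp [hd]
  let b' := b.isUnitSMul hu
  refine ⟨(b'.equiv Complex.basisOneI (Equiv.refl _)).toContinuousLinearEquiv, fun x y => ?_⟩
  have key : ∀ x, (b'.equiv Complex.basisOneI (Equiv.refl _)) x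
      = ⟨b.repr x 0, d * b.repr x 1⟩ := by
    intro x
    have hx : x = b.repr x 0 • b' 0 + (d * b.repr x 1) • b' 1 := by
      conv_lhs => rw [← b.sum_repr x]
      have h0 : b' 0 = b 0 := by simp [b', Module.Basis.isUnitSMul_apply]
      have h1 : b' 1 = d⁻¹ • b 1 := by simp [b', Module.Basis.isUnitSMul_apply]
      have h2 : d * b.repr x 1 * d⁻¹ = b.repr x 1 := by field_simp
      rw [h0, h1, smul_smul, h2, ← Fin.sum_univ_two (fun i => b.repr x i • b i), b.sum_repr]
    conv_lhs => rw [hx]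
    rw [map_add, map_smul, map_smul, Module.Basis.equiv_apply, Module.Basis.equiv_apply]
    apply Complex.ext <;> simp
  simp only [LinearEquiv.coe_toContinuousLinearEquiv', key]
  rw [hexp]
  ring

namespace IsDetCoordinate

variable {X : Type*} [NormedAddCommGroup X] [NormedSpace ℝ X] {ω : LinearMap.BilinForm ℝ X}
  {e : X ≃L[ℝ] ℂ}

theorem self (he : IsDetCoordinate ω e) (x : X) : ω x x = 0 := by
  rw [he]; ring

theorem swap (he : IsDetCoordinate ω e) (x y : X) : ω x y = -ω y x := by
  rw [he, he]; ring

/-- Cramer's rule. -/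
theorem cramer (he : IsDetCoordinate ω e) (x y z : X) :
    ω x y • z = ω z y • x + ω x z • y := by
  apply e.injective
  simp only [map_add, map_smul]
  apply Complex.ext <;> simp [he _ _] <;> ring

theorem exists_smul_of_eq_zero (he : IsDetCoordinate ω e) {x y : X} (hx : x ≠ 0)
    (h : ω x y = 0) : ∃ a : ℝ, y = a • x := by
  have hx' : e x ≠ 0 := by simpa using hx
  have h0 : ω x (e.symm (Complex.I * e x)) ≠ 0 := by
    rw [he]
    simp only [ContinuousLinearEquiv.apply_symm_apply, Complex.mul_im, Complex.mul_re,
      Complex.I_re, Complex.I_im]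
    have := Complex.normSq_pos.2 hx'
    rw [Complex.normSq_apply] at this
    nlinarith
  have h1 := he.cramer x (e.symm (Complex.I * e x)) y
  rw [h, zero_smul, add_zero] at h1
  refine ⟨(ω x (e.symm (Complex.I * e x)))⁻¹ * ω y (e.symm (Complex.I * e x)), ?_⟩
  rw [mul_smul, ← h1, smul_smul, inv_mul_cancel₀ h0, one_smul]

theorem hasDerivAt (he : IsDetCoordinate ω e) {f g : ℝ → X} {f' g' : X} {t : ℝ}
    (hf : HasDerivAt f f' t) (hg : HasDerivAt g g' t) :
    HasDerivAt (fun s => ω (f s) (g s)) (ω f' (g t) + ω (f t) g') t := by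
  have re : ∀ {f : ℝ → X} {f' : X}, HasDerivAt f f' t →
      HasDerivAt (fun s => (e (f s)).re) (e f').re t := fun h =>
    (Complex.reCLM.comp (e : X →L[ℝ] ℂ)).hasFDerivAt.comp_hasDerivAt t h
  have im : ∀ {f : ℝ → X} {f' : X}, HasDerivAt f f' t →
      HasDerivAt (fun s => (e (f s)).im) (e f').im t := fun h =>
    (Complex.imCLM.comp (e : X →L[ℝ] ℂ)).hasFDerivAt.comp_hasDerivAt t h
  have := ((re hf).mul (im hg)).sub ((im hf).mul (re hg))
  simp only [he _ _]
  refine this.congr_deriv ?_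
  ring

theorem hasDerivAt_left (he : IsDetCoordinate ω e) {f : ℝ → X} {f' : X} {t : ℝ}
    (hf : HasDerivAt f f' t) (y : X) : HasDerivAt (fun s => ω (f s) y) (ω f' y) t := by
  simpa using he.hasDerivAt hf (hasDerivAt_const t y)

theorem hasDerivAt_right (he : IsDetCoordinate ω e) {f : ℝ → X} {f' : X} {t : ℝ}
    (hf : HasDerivAt f f' t) (y : X) : HasDerivAt (fun s => ω y (f s)) (ω y f') t := by
  simpa using he.hasDerivAt (hasDerivAt_const t y) hf

theorem contDiff (he : IsDetCoordinate ω e) {f g : ℝ → X} {n : WithTop ℕ∞}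
    (hf : ContDiff ℝ n f) (hg : ContDiff ℝ n g) : ContDiff ℝ n (fun s => ω (f s) (g s)) := by
  have re : ∀ {f : ℝ → X}, ContDiff ℝ n f → ContDiff ℝ n (fun s => (e (f s)).re) := fun h =>
    (Complex.reCLM.comp (e : X →L[ℝ] ℂ)).contDiff.comp h
  have im : ∀ {f : ℝ → X}, ContDiff ℝ n f → ContDiff ℝ n (fun s => (e (f s)).im) := fun h =>
    (Complex.imCLM.comp (e : X →L[ℝ] ℂ)).contDiff.comp h
  simp only [he _ _]
  exact ((re hf).mul (im hg)).sub ((im hf).mul (re hg))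

theorem continuous (he : IsDetCoordinate ω e) {Y : Type*} [TopologicalSpace Y] {f g : Y → X}
    (hf : Continuous f) (hg : Continuous g) : Continuous (fun s => ω (f s) (g s)) := by
  simp only [he _ _]
  fun_prop

end IsDetCoordinate

/-! ### The unit circle in polar coordinates -/

section Polar

variable {X : Type*} [NormedAddCommGroup X] [NormedSpace ℝ X] {ω : LinearMap.BilinForm ℝ X}
  {e : X ≃L[ℝ] ℂ}

/-- The point of the unit circle of `X` in the direction of angle `α`, the angle being measured in
the coordinate `e`. -/
noncomputable def polar (e : X ≃L[ℝ] ℂ) (α : ℝ) : X :=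
  ‖e.symm (Complex.exp (α * Complex.I))‖⁻¹ • e.symm (Complex.exp (α * Complex.I))

theorem norm_symm_exp_pos (e : X ≃L[ℝ] ℂ) (α : ℝ) :
    0 < ‖e.symm (Complex.exp (α * Complex.I))‖ := by
  simp [Complex.exp_ne_zero]

theorem norm_polar (e : X ≃L[ℝ] ℂ) (α : ℝ) : ‖polar e α‖ = 1 := by
  rw [polar, norm_smul, norm_inv, norm_norm, inv_mul_cancel₀ (norm_symm_exp_pos e α).ne']

theorem polar_add_pi (e : X ≃L[ℝ] ℂ) (α : ℝ) : polar e (α + Real.pi) = -polar e α := by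
  have : Complex.exp (((α + Real.pi : ℝ) : ℂ) * Complex.I) = -Complex.exp (α * Complex.I) := by
    push_cast
    rw [add_mul, Complex.exp_add, Complex.exp_pi_mul_I]
    ring
  simp only [polar, this, map_neg, norm_neg, smul_neg]

theorem polar_periodic (e : X ≃L[ℝ] ℂ) : Function.Periodic (polar e) (2 * Real.pi) := by
  intro α
  rw [two_mul, ← add_assoc, polar_add_pi, polar_add_pi, neg_neg]

/-- Distinct angles modulo `2π` give distinct points of the unit circle. -/
theorem exists_int_of_polar_eq {α β : ℝ} (h : polar e α = polar e β) :
    ∃ m : ℤ, α = β + m * (2 * Real.pi) := by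
  have h1 := congrArg e h
  simp only [polar, map_smul, ContinuousLinearEquiv.apply_symm_apply] at h1
  have ha := inv_pos.2 (norm_symm_exp_pos e α)
  have hb := inv_pos.2 (norm_symm_exp_pos e β)
  set a := ‖e.symm (Complex.exp (α * Complex.I))‖⁻¹
  set b := ‖e.symm (Complex.exp (β * Complex.I))‖⁻¹
  have h2 := congrArg norm h1
  rw [norm_smul, norm_smul, Complex.norm_exp_ofReal_mul_I, Complex.norm_exp_ofReal_mul_I,
    Real.norm_of_nonneg ha.le, Real.norm_of_nonneg hb.le, mul_one, mul_one] at h2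
  rw [h2] at h1
  have h3 := smul_right_injective ℂ hb.ne' h1
  obtain ⟨m, hm⟩ := Complex.exp_eq_exp_iff_exists_int.1 h3
  refine ⟨m, ?_⟩
  have := congrArg Complex.im hm
  simpa using this

/-- A curve of class `C^(n+1)` avoiding the origin has an angle function of the same class. -/
theorem exists_angle (he : IsDetCoordinate ω e) {n : ℕ} {x : ℝ → X}
    (hx : ContDiff ℝ (n + 1) x) (hx0 : ∀ t, x t ≠ 0) :
    ∃ θ : ℝ → ℝ, ContDiff ℝ (n + 1) θ ∧ (∀ t, ‖x t‖⁻¹ • x t = polar e (θ t)) ∧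
      ∀ t, deriv θ t * ‖e (x t)‖ ^ 2 = ω (x t) (deriv x t) := by
  set z : ℝ → ℂ := fun t => e (x t) with hz_def
  have hz : ContDiff ℝ (n + 1) z := (e : X →L[ℝ] ℂ).contDiff.comp hx
  have hz0 : ∀ t, z t ≠ 0 := fun t => by simpa [z] using hx0 t
  have hz' : ContDiff ℝ n (deriv z) := (contDiff_succ_iff_deriv.1 hz).2.2
  have hzd : ∀ t, HasDerivAt z (deriv z t) t := fun t =>
    ((hz.differentiable (by simp)) t).hasDerivAt
  have hq : ContDiff ℝ n (fun t => deriv z t / z t) := by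
    simp only [div_eq_mul_inv]
    exact hz'.mul ((hz.of_le (by exact_mod_cast Nat.le_succ n)).inv hz0)
  have hqc := hq.continuous
  set L : ℝ → ℂ := fun t => Complex.log (z 0) + ∫ s in (0:ℝ)..t, deriv z s / z s with hL
  have hLd : ∀ t, HasDerivAt L (deriv z t / z t) t := fun t =>
    (hqc.integral_hasStrictDerivAt 0 t).hasDerivAt.const_add _
  have hexp : ∀ t, z t = Complex.exp (L t) := by
    have hd : ∀ t, HasDerivAt (fun t => z t * Complex.exp (-L t)) 0 t := by
      intro t
      have := (hzd t).mul (hLd t).neg.cexp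
      refine this.congr_deriv ?_
      rw [mul_neg, mul_neg, mul_left_comm, mul_div_cancel₀ _ (hz0 t), mul_comm]
      exact add_neg_cancel _
    intro t
    have := is_const_of_deriv_eq_zero (fun t => (hd t).differentiableAt) (fun t => (hd t).deriv) t 0
    simp only [hL, intervalIntegral.integral_same, add_zero, Complex.exp_neg,
      Complex.exp_log (hz0 0), mul_inv_cancel₀ (hz0 0)] at this
    rwa [mul_inv_eq_one₀ (Complex.exp_ne_zero _)] at this
  have hLs : ContDiff ℝ (n + 1) L := by
    refine contDiff_succ_iff_deriv.2 ⟨fun t => (hLd t).differentiableAt, by simp, ?_⟩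
    rwa [show deriv L = fun t => deriv z t / z t from funext fun t => (hLd t).deriv]
  refine ⟨fun t => (L t).im, Complex.imCLM.contDiff.comp hLs, fun t => ?_, fun t => ?_⟩
  · have h1 : x t = Real.exp (L t).re • e.symm (Complex.exp ((L t).im * Complex.I)) := by
      apply e.injective
      rw [map_smul, e.apply_symm_apply]
      change z t = _
      rw [hexp t]
      conv_lhs => rw [← Complex.re_add_im (L t), Complex.exp_add]
      simp [Complex.real_smul]
    have hr := Real.exp_pos (L t).re
    rw [polar, h1, norm_smul, Real.norm_of_nonneg hr.le, smul_smul]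
    congr 1
    field_simp
  · have h1 : HasDerivAt (fun t => (L t).im) (deriv z t / z t).im t :=
      Complex.imCLM.hasFDerivAt.comp_hasDerivAt t (hLd t)
    have h2 : deriv z t = e (deriv x t) :=
      ((e : X →L[ℝ] ℂ).hasFDerivAt.comp_hasDerivAt t
        ((hx.differentiable (by simp)) t).hasDerivAt).deriv
    rw [h1.deriv, he, h2, Complex.div_im, ← Complex.normSq_eq_norm_sq]
    have : Complex.normSq (z t) ≠ 0 := by simpa using hz0 t
    change (_ * (z t).re / Complex.normSq (z t) - _) * Complex.normSq (z t) = _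
    field_simp
    ring

end Polar

/-! ### Tangents of the unit circle -/

section Tangent

variable {X : Type*} [NormedAddCommGroup X] [NormedSpace ℝ X] {ω : LinearMap.BilinForm ℝ X}
  {e : X ≃L[ℝ] ℂ}

/-- A tangent vector of the unit circle at `φ t` is annihilated by a supporting functional, which
attains its maximum on the circle at `φ t`. -/
theorem exists_support {φ : ℝ → X} (hφ : ∀ t, ‖φ t‖ = 1) {t : ℝ} {φ' : X}
    (h : HasDerivAt φ φ' t) :
    ∃ f : X →L[ℝ] ℝ, f (φ t) = 1 ∧ f φ' = 0 ∧ ∀ y, |f y| ≤ ‖y‖ := by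
  obtain ⟨f, hf, hft⟩ := exists_dual_vector'' ℝ (φ t)
  have hle : ∀ y, |f y| ≤ ‖y‖ := fun y => by
    simpa using f.le_of_opNorm_le hf y
  have h1 : f (φ t) = 1 := by simpa [hφ t] using hft
  refine ⟨f, h1, ?_, hle⟩
  have hmax : IsLocalMax (fun s => f (φ s)) t := Filter.Eventually.of_forall fun s => by
    change f (φ s) ≤ f (φ t)
    rw [h1, ← hφ s]
    exact (le_abs_self _).trans (hle _)
  exact hmax.hasDerivAt_eq_zero (f.hasFDerivAt.comp_hasDerivAt t h)

theorem form_tangent_ne_zero (he : IsDetCoordinate ω e) {φ : ℝ → X} (hφ : ∀ t, ‖φ t‖ = 1) {t : ℝ}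
    {φ' : X} (h : HasDerivAt φ φ' t) (h0 : φ' ≠ 0) : ω (φ t) φ' ≠ 0 := by
  intro hz
  obtain ⟨f, h1, h2, -⟩ := exists_support hφ h
  have hne : φ t ≠ 0 := fun h => by simp [h] at h1
  obtain ⟨a, rfl⟩ := he.exists_smul_of_eq_zero hne hz
  rw [map_smul, h1, smul_eq_mul, mul_one] at h2
  simp [h2] at h0

/-- The unit ball lies in the strip bounded by the tangents of the unit circle at `±φ t`. -/
theorem abs_form_tangent_le (he : IsDetCoordinate ω e) {φ : ℝ → X} (hφ : ∀ t, ‖φ t‖ = 1) {t : ℝ}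
    {φ' : X} (h : HasDerivAt φ φ' t) (y : X) : |ω y φ'| ≤ |ω (φ t) φ'| * ‖y‖ := by
  obtain ⟨f, h1, h2, h3⟩ := exists_support hφ h
  have := congrArg f (he.cramer (φ t) φ' y)
  simp only [map_add, map_smul, h1, h2, smul_eq_mul, mul_one, mul_zero, add_zero] at this
  rw [← this, abs_mul]
  exact mul_le_mul_of_nonneg_left (h3 y) (abs_nonneg _)

/-- If the boundary of a strictly convex set is the unit circle, then the norm is strictly
convex. -/
theorem eq_of_norm_add_eq_two {K : Set X} (hK : StrictConvex ℝ K) (hKc : IsClosed K)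
    (hKS : frontier K = sphere (0 : X) 1) {x y : X} (hx : ‖x‖ = 1) (hy : ‖y‖ = 1)
    (hxy : ‖x + y‖ = 2) : x = y := by
  by_contra hne
  have mem : ∀ {x : X}, ‖x‖ = 1 → x ∈ K := fun h =>
    hKc.frontier_subset (hKS ▸ mem_sphere_zero_iff_norm.2 h)
  have h1 := hK (mem hx) (mem hy) hne (a := 1 / 2) (b := 1 / 2) (by norm_num) (by norm_num)
    (by norm_num)
  have h2 : (1 / 2 : ℝ) • x + (1 / 2 : ℝ) • y ∈ frontier K := by
    rw [hKS, mem_sphere_zero_iff_norm, ← smul_add, norm_smul, hxy]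
    norm_num
  exact h2.2 h1

/-- On a strictly convex unit circle, the tangent vector determines its point of contact, given
on which side of the origin it lies. -/
theorem eq_of_tangent_eq (he : IsDetCoordinate ω e)
    (hsc : ∀ x y : X, ‖x‖ = 1 → ‖y‖ = 1 → ‖x + y‖ = 2 → x = y)
    {φ φ₁ : ℝ → X} (hφ : ∀ t, ‖φ t‖ = 1) (hφ₁ : ∀ t, ‖φ₁ t‖ = 1) {s t : ℝ} {w : X}
    (hs : HasDerivAt φ w s) (ht : HasDerivAt φ₁ w t) (hsw : 0 < ω (φ s) w)
    (htw : 0 < ω (φ₁ t) w) :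
    φ s = φ₁ t := by
  have h1 := abs_form_tangent_le he hφ hs (φ₁ t)
  have h2 := abs_form_tangent_le he hφ₁ ht (φ s)
  have h3 := abs_form_tangent_le he hφ hs (φ s + φ₁ t)
  rw [hφ₁, abs_of_pos hsw, abs_of_pos htw, mul_one] at h1
  rw [hφ, abs_of_pos hsw, abs_of_pos htw, mul_one] at h2
  rw [map_add, LinearMap.add_apply, abs_of_pos hsw, abs_of_pos (add_pos hsw htw),
    le_antisymm h1 h2] at h3
  refine hsc _ _ (hφ s) (hφ₁ t) (le_antisymm ?_ ?_)
  · have := norm_add_le (φ s) (φ₁ t)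
    rw [hφ, hφ₁] at this
    linarith
  · nlinarith

/-- The polar parametrization of the unit circle is of class `C²` as soon as the circle has a
regular parametrization of class `C²`. -/
theorem contDiff_polar (he : IsDetCoordinate ω e) {σ : ℝ → X} (hσ : ContDiff ℝ 2 σ)
    (hσ' : ∀ t, deriv σ t ≠ 0) (hσS : range σ = sphere (0 : X) 1) : ContDiff ℝ 2 (polar e) := by
  have hn : ∀ t, ‖σ t‖ = 1 := fun t => by
    have := mem_range_self (f := σ) t
    rwa [hσS, mem_sphere_zero_iff_norm] at this
  have h0 : ∀ t, σ t ≠ 0 := fun t h => by simpa [h] using hn t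
  have h2 : ((1 : ℕ) + 1 : WithTop ℕ∞) = 2 := by norm_num
  obtain ⟨θ, hθ, hσθ, hθ'⟩ := exists_angle he (n := 1) (h2 ▸ hσ) h0
  rw [h2] at hθ
  have hθ0 : ∀ t, deriv θ t ≠ 0 := fun t h => by
    have h3 := hθ' t
    rw [h, zero_mul] at h3
    exact form_tangent_ne_zero he hn ((hσ.differentiable (by simp)) t).hasDerivAt (hσ' t) h3.symm
  refine contDiff_iff_contDiffAt.2 fun α => ?_
  obtain ⟨t, ht⟩ : polar e α ∈ range σ := by
    rw [hσS, mem_sphere_zero_iff_norm, norm_polar]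
  have hpol : ∀ t, polar e (θ t) = σ t := fun t => by
    rw [← hσθ, hn, inv_one, one_smul]
  obtain ⟨m, hm⟩ := exists_int_of_polar_eq ((hpol t).trans ht)
  have hd : HasFDerivAt θ
      (ContinuousLinearEquiv.unitsEquivAut ℝ (Units.mk0 _ (hθ0 t)) : ℝ →L[ℝ] ℝ) t :=
    ((hθ.differentiable (by simp)) t).hasDerivAt.hasFDerivAt_equiv (hθ0 t)
  have h2' : (2 : WithTop ℕ∞) ≠ 0 := by simp
  set ψ := hθ.contDiffAt.localInverse hd h2' with hψ
  have hψs : ContDiffAt ℝ 2 ψ (θ t) := hθ.contDiffAt.to_localInverse hd h2'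
  have hψr : ∀ᶠ β in nhds (θ t), θ (ψ β) = β :=
    (hθ.contDiffAt.hasStrictFDerivAt' hd h2').eventually_right_inverse
  -- near `α`, the polar parametrization is `σ` composed with a local inverse of its angle
  have hshift : Filter.Tendsto (fun β => β + m * (2 * Real.pi)) (nhds α) (nhds (θ t)) := by
    rw [hm]
    exact (continuous_id.add continuous_const).tendsto α
  have hev : polar e =ᶠ[nhds α] fun β => σ (ψ (β + m * (2 * Real.pi))) := by
    filter_upwards [hshift.eventually hψr] with β hβ
    rw [← hpol, hβ]
    exact ((polar_periodic e).int_mul m β).symm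
  refine ContDiffAt.congr_of_eventuallyEq ?_ hev
  refine hσ.contDiffAt.comp α (ContDiffAt.comp α ?_ ?_)
  · rwa [← hm]
  · exact (contDiff_id.add contDiff_const).contDiffAt

theorem form_polar_pos (he : IsDetCoordinate ω e) (hΦ : ContDiff ℝ 2 (polar e)) (α : ℝ) :
    0 < ω (polar e α) (deriv (polar e) α) := by
  have hd : ∀ α, HasDerivAt (polar e) (deriv (polar e) α) α := fun α =>
    ((hΦ.differentiable (by simp)) α).hasDerivAt
  set r : ℝ → ℝ := fun α => ‖e.symm (Complex.exp (α * Complex.I))‖⁻¹ with hr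
  have hz : ∀ α, e (polar e α) = r α * Complex.exp (α * Complex.I) := fun α => by
    rw [polar, map_smul, e.apply_symm_apply, Complex.real_smul]
  have hre : ∀ α, (e (polar e α)).re = r α * Real.cos α := fun α => by
    rw [hz, Complex.re_ofReal_mul, Complex.exp_ofReal_mul_I_re]
  have him : ∀ α, (e (polar e α)).im = r α * Real.sin α := fun α => by
    rw [hz, Complex.im_ofReal_mul, Complex.exp_ofReal_mul_I_im]
  have hre' : HasDerivAt (fun s => r s * Real.cos s) (e (deriv (polar e) α)).re α := by
    simp only [← hre]
    exact (Complex.reCLM.comp (e : X →L[ℝ] ℂ)).hasFDerivAt.comp_hasDerivAt α (hd α)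
  have him' : HasDerivAt (fun s => r s * Real.sin s) (e (deriv (polar e) α)).im α := by
    simp only [← him]
    exact (Complex.imCLM.comp (e : X →L[ℝ] ℂ)).hasFDerivAt.comp_hasDerivAt α (hd α)
  obtain ⟨r', hr'⟩ : ∃ r', HasDerivAt r r' α := by
    refine ⟨_, ((hre'.mul (Real.hasDerivAt_cos α)).add
      (him'.mul (Real.hasDerivAt_sin α))).congr_of_eventuallyEq (Filter.Eventually.of_forall ?_)⟩
    intro s
    simp only [Pi.add_apply, Pi.mul_apply]
    linear_combination (-r s) * Real.sin_sq_add_cos_sq s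
  have h3 := (hr'.mul (Real.hasDerivAt_sin α)).unique him'
  have h4 := (hr'.mul (Real.hasDerivAt_cos α)).unique hre'
  have hrpos : 0 < r α := inv_pos.2 (norm_symm_exp_pos e α)
  rw [he, hre, him, ← h3, ← h4]
  have h5 : 0 < r α ^ 2 := by positivity
  linear_combination h5 - r α ^ 2 * Real.sin_sq_add_cos_sq α

theorem deriv_polar_ne_zero (he : IsDetCoordinate ω e) (hΦ : ContDiff ℝ 2 (polar e)) (α : ℝ) :
    deriv (polar e) α ≠ 0 := fun h => by
  simpa [h] using form_polar_pos he hΦ α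

theorem hasDerivAt_polar (hΦ : ContDiff ℝ 2 (polar e)) (α : ℝ) :
    HasDerivAt (polar e) (deriv (polar e) α) α :=
  ((hΦ.differentiable (by simp)) α).hasDerivAt

theorem deriv_polar_add_pi (e : X ≃L[ℝ] ℂ) (α : ℝ) :
    deriv (polar e) (α + Real.pi) = -deriv (polar e) α := by
  rw [← deriv_comp_add_const, ← deriv.fun_neg]
  congr 1
  funext β
  exact polar_add_pi e β

theorem contDiff_deriv_polar (hΦ : ContDiff ℝ 2 (polar e)) : ContDiff ℝ 1 (deriv (polar e)) := by
  have h2 : (2 : WithTop ℕ∞) = 1 + 1 := by norm_num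
  rw [h2] at hΦ
  exact (contDiff_succ_iff_deriv.1 hΦ).2.2

end Tangent

/-! ### The normal field of the unit circle -/

section Normal

variable {X : Type*} [NormedAddCommGroup X] [NormedSpace ℝ X] {ω : LinearMap.BilinForm ℝ X}
  {e : X ≃L[ℝ] ℂ}

theorem Function.Periodic.deriv_periodic {f : ℝ → X} {c : ℝ} (hf : Function.Periodic f c) :
    Function.Periodic (deriv f) c := fun x => by
  rw [← deriv_comp_add_const]
  exact congrArg (fun g => deriv g x) (funext hf)

/-- The right normal of the unit circle at the point of angle `α`, which lies on the unit circle of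
the anti-norm. -/
noncomputable def polarNormal (ω : LinearMap.BilinForm ℝ X) (e : X ≃L[ℝ] ℂ) (α : ℝ) : X :=
  (ω (polar e α) (deriv (polar e) α))⁻¹ • deriv (polar e) α

theorem form_polar_polarNormal (he : IsDetCoordinate ω e) (hΦ : ContDiff ℝ 2 (polar e)) (α : ℝ) :
    ω (polar e α) (polarNormal ω e α) = 1 := by
  rw [polarNormal, map_smul, smul_eq_mul, inv_mul_cancel₀ (form_polar_pos he hΦ α).ne']

theorem smul_polarNormal (he : IsDetCoordinate ω e) (hΦ : ContDiff ℝ 2 (polar e)) (α : ℝ) :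
    ω (polar e α) (deriv (polar e) α) • polarNormal ω e α = deriv (polar e) α := by
  rw [polarNormal, smul_inv_smul₀ (form_polar_pos he hΦ α).ne']

theorem abs_form_polarNormal_le (he : IsDetCoordinate ω e) (hΦ : ContDiff ℝ 2 (polar e)) (α : ℝ)
    (y : X) : |ω y (polarNormal ω e α)| ≤ ‖y‖ := by
  have h0 := form_polar_pos he hΦ α
  have := abs_form_tangent_le he (norm_polar e) (hasDerivAt_polar hΦ α) y
  rw [abs_of_pos h0] at this
  rw [polarNormal, map_smul, smul_eq_mul, abs_mul, abs_inv, abs_of_pos h0,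
    inv_mul_le_iff₀ h0]
  exact this

theorem contDiff_polarNormal (he : IsDetCoordinate ω e) (hΦ : ContDiff ℝ 2 (polar e)) :
    ContDiff ℝ 1 (polarNormal ω e) :=
  ((he.contDiff (hΦ.of_le (by norm_num)) (contDiff_deriv_polar hΦ)).inv
    fun α => (form_polar_pos he hΦ α).ne').smul (contDiff_deriv_polar hΦ)

theorem hasDerivAt_polarNormal (he : IsDetCoordinate ω e) (hΦ : ContDiff ℝ 2 (polar e)) (α : ℝ) :
    HasDerivAt (polarNormal ω e) (deriv (polarNormal ω e) α) α :=
  (((contDiff_polarNormal he hΦ).differentiable (by simp)) α).hasDerivAt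

theorem polarNormal_periodic (ω : LinearMap.BilinForm ℝ X) (e : X ≃L[ℝ] ℂ) :
    Function.Periodic (polarNormal ω e) (2 * Real.pi) := fun α => by
  rw [polarNormal, polar_periodic e, (polar_periodic e).deriv_periodic α]
  rfl

theorem deriv_polarNormal (he : IsDetCoordinate ω e) (hΦ : ContDiff ℝ 2 (polar e)) (α : ℝ) :
    deriv (polarNormal ω e) α =
      ω (polarNormal ω e α) (deriv (polarNormal ω e) α) • -polar e α := by
  have h1 := he.hasDerivAt (hasDerivAt_polar hΦ α) (hasDerivAt_polarNormal he hΦ α)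
  simp only [form_polar_polarNormal he hΦ] at h1
  have h2 := h1.unique (hasDerivAt_const α 1)
  rw [← smul_polarNormal he hΦ α, map_smul, LinearMap.smul_apply, he.self, smul_zero,
    zero_add] at h2
  have h3 := he.cramer (polar e α) (polarNormal ω e α) (deriv (polarNormal ω e) α)
  rw [form_polar_polarNormal he hΦ, one_smul, h2, zero_smul, add_zero] at h3
  rw [he.swap, smul_neg, neg_smul, neg_neg]
  exact h3

/-- The curve of right normals turns counterclockwise, because the unit ball is convex. -/
theorem form_polarNormal_nonneg (he : IsDetCoordinate ω e) (hΦ : ContDiff ℝ 2 (polar e)) (α : ℝ) :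
    0 ≤ ω (polarNormal ω e α) (deriv (polarNormal ω e) α) := by
  set Φ := polar e with hΦ_def
  set N := polarNormal ω e with hN
  have hle : ∀ α β, ω (Φ α) (N β) ≤ 1 := fun α β =>
    (le_abs_self _).trans ((abs_form_polarNormal_le he hΦ β _).trans_eq (norm_polar e α))
  have h1 : Filter.Tendsto (fun β => ω (slope Φ α β) (slope N α β)) (nhdsWithin α {α}ᶜ)
      (nhds (ω (deriv Φ α) (deriv N α))) :=
    ((he.continuous continuous_fst continuous_snd).tendsto (deriv Φ α, deriv N α)).comp
      ((hasDerivAt_iff_tendsto_slope.1 (hasDerivAt_polar hΦ α)).prodMk_nhds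
        (hasDerivAt_iff_tendsto_slope.1 (hasDerivAt_polarNormal he hΦ α)))
  have h2 : 0 ≤ ω (deriv Φ α) (deriv N α) := by
    refine ge_of_tendsto' h1 fun β => ?_
    simp only [slope, vsub_eq_sub, map_smul, LinearMap.smul_apply, smul_eq_mul, map_sub,
      LinearMap.sub_apply]
    have h3 := hle α β
    have h4 := hle β α
    have h5 := form_polar_polarNormal he hΦ α
    have h6 := form_polar_polarNormal he hΦ β
    have h7 := mul_self_nonneg (β - α)⁻¹
    rw [← mul_sub, ← mul_assoc]
    refine mul_nonneg h7 ?_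
    change ω (Φ α) (N α) = 1 at h5
    change ω (Φ β) (N β) = 1 at h6
    linarith
  rw [← smul_polarNormal he hΦ α, map_smul, LinearMap.smul_apply, smul_eq_mul] at h2
  exact nonneg_of_mul_nonneg_right h2 (form_polar_pos he hΦ α)

/-- Where the curve of right normals is constant, so is the point of the unit circle, by strict
convexity. -/
theorem polar_eq_of_polarNormal_eq (he : IsDetCoordinate ω e) (hΦ : ContDiff ℝ 2 (polar e))
    (hsc : ∀ x y : X, ‖x‖ = 1 → ‖y‖ = 1 → ‖x + y‖ = 2 → x = y) {α β : ℝ}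
    (h : polarNormal ω e α = polarNormal ω e β) : polar e α = polar e β := by
  refine hsc _ _ (norm_polar e α) (norm_polar e β) (le_antisymm ?_ ?_)
  · have := norm_add_le (polar e α) (polar e β)
    rw [norm_polar, norm_polar] at this
    linarith
  · have h1 := (le_abs_self _).trans (abs_form_polarNormal_le he hΦ α (polar e α + polar e β))
    rw [map_add, LinearMap.add_apply, form_polar_polarNormal he hΦ, h,
      form_polar_polarNormal he hΦ] at h1
    linarith

/-- The speed of the curve of right normals may vanish, but on no interval. -/
theorem strictMono_integral_form_polarNormal (he : IsDetCoordinate ω e)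
    (hΦ : ContDiff ℝ 2 (polar e))
    (hsc : ∀ x y : X, ‖x‖ = 1 → ‖y‖ = 1 → ‖x + y‖ = 2 → x = y) :
    StrictMono fun α =>
      ∫ s in (0 : ℝ)..α, ω (polarNormal ω e s) (deriv (polarNormal ω e) s) := by
  set b : ℝ → ℝ := fun s => ω (polarNormal ω e s) (deriv (polarNormal ω e) s) with hb
  have hbc : Continuous b := he.continuous (contDiff_polarNormal he hΦ).continuous
    ((contDiff_polarNormal he hΦ).continuous_deriv (by simp))
  have hd : ∀ α, HasDerivAt (fun α => ∫ s in (0 : ℝ)..α, b s) (b α) α := fun α =>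
    (hbc.integral_hasStrictDerivAt 0 α).hasDerivAt
  have hmono : Monotone (fun α => ∫ s in (0 : ℝ)..α, b s) :=
    monotone_of_deriv_nonneg (fun α => (hd α).differentiableAt) fun α => by
      rw [(hd α).deriv]; exact form_polarNormal_nonneg he hΦ α
  intro x y hxy
  refine (hmono hxy.le).lt_of_ne fun heq => ?_
  have hb0 : ∀ z ∈ Ioo x y, b z = 0 := by
    intro z hz
    refine (hd z).unique ((hasDerivAt_const z (∫ s in (0 : ℝ)..x, b s)).congr_of_eventuallyEq ?_)
    filter_upwards [Ioo_mem_nhds hz.1 hz.2] with w hw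
    exact le_antisymm ((hmono hw.2.le).trans_eq heq.symm) (hmono hw.1.le)
  obtain ⟨w, hw⟩ := exists_between hxy
  refine deriv_polar_ne_zero he hΦ w ((hasDerivAt_polar hΦ w).unique
    ((hasDerivAt_const w (polar e w)).congr_of_eventuallyEq ?_))
  filter_upwards [Ioo_mem_nhds hw.1 hw.2] with z hz
  refine polar_eq_of_polarNormal_eq he hΦ hsc ?_
  refine isOpen_Ioo.is_const_of_deriv_eq_zero isPreconnected_Ioo
    ((contDiff_polarNormal he hΦ).differentiable (by simp)).differentiableOn ?_ hz hw
  intro u hu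
  rw [deriv_polarNormal he hΦ]
  change b u • _ = _
  rw [hb0 u hu, zero_smul]
  rfl

theorem antiNorm_eq_one (he : IsDetCoordinate ω e) {x y : X} (hy : ‖y‖ = 1) (hyx : ω y x = 1)
    (h : ∀ z, |ω z x| ≤ ‖z‖) : antiNorm ω x = 1 := by
  have hle : ∀ r ∈ (fun y => |ω x y|) '' sphere (0 : X) 1, r ≤ 1 := by
    rintro _ ⟨z, hz, rfl⟩
    change |ω x z| ≤ 1
    rw [he.swap, abs_neg, ← mem_sphere_zero_iff_norm.1 hz]
    exact h z
  have hmem : (1 : ℝ) ∈ (fun y => |ω x y|) '' sphere (0 : X) 1 :=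
    ⟨y, mem_sphere_zero_iff_norm.2 hy, by
      change |ω x y| = 1
      rw [he.swap, abs_neg, hyx, abs_one]⟩
  exact le_antisymm (csSup_le ⟨1, hmem⟩ hle) (le_csSup ⟨1, hle⟩ hmem)

theorem abs_form_le_one_of_antiNorm_eq_one {x y : X} (hx : antiNorm ω x = 1) (hy : ‖y‖ = 1) :
    |ω x y| ≤ 1 := by
  have hbdd : BddAbove ((fun y => |ω x y|) '' sphere (0 : X) 1) := by
    by_contra h
    -- the supremum of an unbounded set of reals is `0` by convention
    rw [antiNorm, Real.sSup_of_not_bddAbove h] at hx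
    exact zero_ne_one hx
  rw [← hx]
  exact le_csSup hbdd ⟨y, mem_sphere_zero_iff_norm.2 hy, rfl⟩

/-- Birkhoff orthogonality `x ⊣ n` says that the unit ball lies in the strip between the lines
through `±x` parallel to `n`. -/
theorem BirkhoffOrthogonal.abs_form_le (he : IsDetCoordinate ω e) {x n : X} (hx : ‖x‖ = 1)
    (h : BirkhoffOrthogonal x n) (hxn : ω x n = 1) (y : X) : |ω y n| ≤ ‖y‖ := by
  have h1 := he.cramer x n y
  rw [hxn, one_smul] at h1
  set a := ω y n
  set b := ω x y
  rcases eq_or_ne a 0 with h0 | h0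
  · rw [h0, abs_zero]
    exact norm_nonneg y
  · have h2 : y = a • (x + (a⁻¹ * b) • n) := by
      rw [smul_add, smul_smul, mul_inv_cancel_left₀ h0]
      exact h1
    rw [h2, norm_smul, Real.norm_eq_abs]
    have := h (a⁻¹ * b)
    rw [hx] at this
    exact le_mul_of_one_le_right (abs_nonneg a) this

theorem birkhoffOrthogonal_of_abs_form_le (he : IsDetCoordinate ω e) {x n : X} (hx : ‖x‖ = 1)
    (hxn : ω x n = 1) (h : ∀ y, |ω y n| ≤ ‖y‖) : BirkhoffOrthogonal x n := fun t => by
  have := (le_abs_self _).trans (h (x + t • n))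
  rwa [map_add, LinearMap.add_apply, map_smul, LinearMap.smul_apply, he.self, smul_zero, add_zero,
    hxn, ← hx] at this

/-- The unit circle is smooth, so it has only one right normal at each point. -/
theorem eq_polarNormal (he : IsDetCoordinate ω e) (hΦ : ContDiff ℝ 2 (polar e)) {α : ℝ} {n : X}
    (h : BirkhoffOrthogonal (polar e α) n) (hn : ω (polar e α) n = 1) : n = polarNormal ω e α := by
  have hmax : IsLocalMax (fun β => ω (polar e β) n) α := Filter.Eventually.of_forall fun β => by
    change ω (polar e β) n ≤ ω (polar e α) n
    rw [hn, ← norm_polar e β]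
    exact (le_abs_self _).trans (h.abs_form_le he (norm_polar e α) hn _)
  have h1 := hmax.hasDerivAt_eq_zero (he.hasDerivAt_left (hasDerivAt_polar hΦ α) n)
  rw [← smul_polarNormal he hΦ α, map_smul, LinearMap.smul_apply, smul_eq_mul,
    mul_eq_zero, or_iff_right (form_polar_pos he hΦ α).ne'] at h1
  have h2 := he.cramer (polar e α) (polarNormal ω e α) n
  rwa [form_polar_polarNormal he hΦ, one_smul, hn, one_smul, he.swap, h1, neg_zero, zero_smul,
    zero_add] at h2

end Normal

/-! ### Reparametrization -/

section Reparametrization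

theorem exists_homeomorph_of_strictMono {f : ℝ → ℝ} (hf : Continuous f) (hm : StrictMono f)
    {c δ : ℝ} (hδ : 0 < δ) (h : ∀ x, f x + δ ≤ f (x + c)) : ∃ g : ℝ ≃ₜ ℝ, ⇑g = f := by
  have hup : ∀ n : ℕ, f 0 + n * δ ≤ f (n * c) := by
    intro n
    induction n with
    | zero => simp
    | succ n ih =>
      have := h (n * c)
      push_cast
      rw [add_mul, add_mul, one_mul, one_mul]
      linarith
  have hdown : ∀ n : ℕ, f (-(n * c)) ≤ f 0 - n * δ := by
    intro n
    induction n with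
    | zero => simp
    | succ n ih =>
      have := h (-((n + 1 : ℕ) * c))
      have h2 : -((n + 1 : ℕ) * c) + c = -(n * c) := by push_cast; ring
      rw [h2] at this
      push_cast at this ⊢
      rw [add_mul (n : ℝ) 1 δ, one_mul]
      linarith
  have hsurj : Function.Surjective f := by
    refine hf.surjective (Filter.tendsto_atTop_atTop_of_monotone hm.monotone fun b => ?_)
      (Filter.tendsto_atBot_atBot_of_monotone hm.monotone fun b => ?_)
    · obtain ⟨n, hn⟩ := exists_nat_ge ((b - f 0) / δ)
      rw [div_le_iff₀ hδ] at hn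
      exact ⟨_, le_trans (by linarith) (hup n)⟩
    · obtain ⟨n, hn⟩ := exists_nat_ge ((f 0 - b) / δ)
      rw [div_le_iff₀ hδ] at hn
      exact ⟨_, (hdown n).trans (by linarith)⟩
  exact ⟨(hm.orderIsoOfSurjective f hsurj).toHomeomorph, rfl⟩

/-- A curve `N` with `N' = g • M` can be reparametrized by `∫ g`, even where `g` vanishes: the new
curve is the integral of `M`, hence of class `C¹`. -/
theorem exists_reparametrization {X : Type*} [NormedAddCommGroup X] [NormedSpace ℝ X]
    [CompleteSpace X] {g : ℝ → ℝ} (hg : Continuous g) {c : ℝ} (hc : 0 < c)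
    (hgp : Function.Periodic g c) (hm : StrictMono fun x => ∫ s in (0 : ℝ)..x, g s)
    {N M : ℝ → X} (hN : ∀ x, HasDerivAt N (g x • M x) x) (hM : Continuous M) :
    ∃ (ψ : ℝ → X) (h : ℝ ≃ₜ ℝ), ContDiff ℝ 1 h ∧ ContDiff ℝ 1 ψ ∧ (∀ x, ψ (h x) = N x) ∧
      ∀ x, deriv ψ (h x) = M x := by
  set G : ℝ → ℝ := fun x => ∫ s in (0 : ℝ)..x, g s with hG
  have hGd : ∀ x, HasDerivAt G (g x) x := fun x =>
    (hg.integral_hasStrictDerivAt 0 x).hasDerivAt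
  have hGs : ContDiff ℝ 1 G := contDiff_one_iff_deriv.2
    ⟨fun x => (hGd x).differentiableAt, by rwa [funext fun x => (hGd x).deriv]⟩
  have hG0 : G 0 = 0 := intervalIntegral.integral_same
  have hδ : 0 < G c := hG0 ▸ hm hc
  obtain ⟨h, hh⟩ := exists_homeomorph_of_strictMono hGs.continuous hm hδ fun x => by
    have h1 : G (x + c) = G x + ∫ s in x..x + c, g s :=
      (intervalIntegral.integral_add_adjacent_intervals (hg.intervalIntegrable _ _)
        (hg.intervalIntegrable _ _)).symm
    rw [h1, hgp.intervalIntegral_add_eq x 0, zero_add]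
  have hMc : Continuous fun v => M (h.symm v) := hM.comp h.symm.continuous
  set ψ : ℝ → X := fun v => N 0 + ∫ s in (0 : ℝ)..v, M (h.symm s) with hψ
  have hψd : ∀ v, HasDerivAt ψ (M (h.symm v)) v := fun v =>
    (hMc.integral_hasStrictDerivAt 0 v).hasDerivAt.const_add _
  have hψh : ∀ x, ψ (h x) = N x := by
    have hd : ∀ x, HasDerivAt (fun x => ψ (h x) - N x) 0 x := by
      intro x
      have h1 : HasDerivAt h (g x) x := by rw [hh]; exact hGd x
      have h2 := ((hψd (h x)).scomp x h1).sub (hN x)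
      refine h2.congr_deriv ?_
      rw [h.symm_apply_apply, sub_self]
    intro x
    have := is_const_of_deriv_eq_zero (fun t => (hd t).differentiableAt) (fun t => (hd t).deriv) x 0
    rw [hh] at this
    simp only [hG0, hψ, intervalIntegral.integral_same, add_zero, sub_self] at this
    rw [hh]
    exact sub_eq_zero.1 this
  refine ⟨ψ, h, by rwa [hh], contDiff_one_iff_deriv.2 ⟨fun v => (hψd v).differentiableAt, ?_⟩,
    hψh, fun x => ?_⟩
  · rwa [funext fun v => (hψd v).deriv]
  · rw [(hψd (h x)).deriv, h.symm_apply_apply]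

end Reparametrization

/-! ### Existence of the curvatures -/

section Existence

variable {X : Type*} [NormedAddCommGroup X] [NormedSpace ℝ X] {ω : LinearMap.BilinForm ℝ X}
  {e : X ≃L[ℝ] ℂ} {γ : ℝ → X} {c : ℝ}

theorem IsSimpleClosedCurve.hasDerivAt (hγ : IsSimpleClosedCurve γ c) (τ : ℝ) :
    HasDerivAt γ (deriv γ τ) τ :=
  ((hγ.contDiff.differentiable (by simp)) τ).hasDerivAt

theorem IsSimpleClosedCurve.contDiff_deriv (hγ : IsSimpleClosedCurve γ c) :
    ContDiff ℝ 1 (deriv γ) := by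
  have h := hγ.contDiff
  rw [show (2 : WithTop ℕ∞) = 1 + 1 by norm_num] at h
  exact (contDiff_succ_iff_deriv.1 h).2.2

theorem IsSimpleClosedCurve.norm_deriv_pos (hγ : IsSimpleClosedCurve γ c) (τ : ℝ) :
    0 < ‖deriv γ τ‖ :=
  norm_pos_iff.2 (hγ.regular τ)

theorem IsSimpleClosedCurve.norm_unitTangent (hγ : IsSimpleClosedCurve γ c) (τ : ℝ) :
    ‖unitTangent γ τ‖ = 1 := by
  rw [unitTangent, norm_smul, norm_inv, norm_norm, inv_mul_cancel₀ (hγ.norm_deriv_pos τ).ne']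

theorem IsSimpleClosedCurve.periodic_deriv (hγ : IsSimpleClosedCurve γ c) :
    Function.Periodic (deriv γ) c :=
  hγ.periodic.deriv_periodic

theorem IsSimpleClosedCurve.periodic_unitTangent (hγ : IsSimpleClosedCurve γ c) :
    Function.Periodic (unitTangent γ) c := fun τ => by
  rw [unitTangent, hγ.periodic_deriv τ, unitTangent]

theorem IsSimpleClosedCurve.exists_tangent_angle (hγ : IsSimpleClosedCurve γ c)
    (he : IsDetCoordinate ω e) :
    ∃ θ : ℝ → ℝ, ContDiff ℝ 1 θ ∧ ∀ τ, unitTangent γ τ = polar e (θ τ) := by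
  obtain ⟨θ, h1, h2, -⟩ := exists_angle he (n := 0) (by simpa using hγ.contDiff_deriv) hγ.regular
  exact ⟨θ, by simpa using h1, h2⟩

theorem IsSimpleClosedCurve.exists_isArcLengthDeriv (hγ : IsSimpleClosedCurve γ c) {f : ℝ → ℝ}
    (hf : ContDiff ℝ 1 f) : ∃ k, IsArcLengthDeriv γ f k :=
  ⟨fun τ => deriv f τ / ‖deriv γ τ‖, hf, fun τ =>
    (div_mul_cancel₀ _ (hγ.norm_deriv_pos τ).ne').symm⟩

theorem IsArcLengthDeriv.continuous {f k : ℝ → ℝ} (h : IsArcLengthDeriv γ f k)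
    (hγ : IsSimpleClosedCurve γ c) : Continuous k := by
  have : k = fun τ => deriv f τ / ‖deriv γ τ‖ := funext fun τ => by
    rw [h.2, mul_div_cancel_right₀ _ (hγ.norm_deriv_pos τ).ne']
  rw [this]
  exact (h.1.continuous_deriv (by simp)).div hγ.contDiff_deriv.continuous.norm
    fun τ => (hγ.norm_deriv_pos τ).ne'

theorem IsArcLengthDeriv.smul_deriv {f k : ℝ → ℝ} (h : IsArcLengthDeriv γ f k)
    (hγ : IsSimpleClosedCurve γ c) (τ : ℝ) :
    k τ • deriv γ τ = deriv f τ • unitTangent γ τ := by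
  rw [h.2, unitTangent, smul_smul, mul_inv_cancel_right₀ (hγ.norm_deriv_pos τ).ne']

theorem strictMono_integral_of_pos {g : ℝ → ℝ} (hg : Continuous g) (h0 : ∀ x, 0 < g x) :
    StrictMono fun x => ∫ s in (0 : ℝ)..x, g s :=
  strictMono_of_deriv_pos fun x => by
    rw [(hg.integral_hasStrictDerivAt 0 x).hasDerivAt.deriv]
    exact h0 x

theorem exists_isMinkowskiCurvature [CompleteSpace X] (he : IsDetCoordinate ω e)
    (hΦ : ContDiff ℝ 2 (polar e)) (hγ : IsSimpleClosedCurve γ c) :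
    ∃ k, IsMinkowskiCurvature ω γ k := by
  have hg : Continuous fun α => ω (polar e α) (deriv (polar e) α) :=
    he.continuous hΦ.continuous (contDiff_deriv_polar hΦ).continuous
  obtain ⟨φ, h, hh, hφ, hφN, hφM⟩ := exists_reparametrization hg Real.two_pi_pos
    (fun α => by
      rw [polar_periodic e, (polar_periodic e).deriv_periodic])
    (strictMono_integral_of_pos hg (form_polar_pos he hΦ))
    (N := polar e) (M := polarNormal ω e)
    (fun α => by rw [smul_polarNormal he hΦ]; exact hasDerivAt_polar hΦ α)
    (contDiff_polarNormal he hΦ).continuous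
  obtain ⟨θ, hθ, hT⟩ := hγ.exists_tangent_angle he
  obtain ⟨k, hk⟩ := hγ.exists_isArcLengthDeriv (hh.comp hθ)
  refine ⟨k, φ, _, ⟨hφ, fun u => ?_, fun u => ?_⟩, fun τ => ?_, hk⟩
  · rw [← h.apply_symm_apply u, hφN, mem_sphere_zero_iff_norm, norm_polar]
  · rw [← h.apply_symm_apply u, hφN, hφM, form_polar_polarNormal he hΦ]
  · rw [Function.comp_apply, hφN, hT]

/-- Arc length is an admissible parameter of the unit circle. -/
theorem exists_isArcLengthParam [CompleteSpace X] (he : IsDetCoordinate ω e)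
    (hΦ : ContDiff ℝ 2 (polar e)) :
    ∃ (φ : ℝ → X) (h : ℝ ≃ₜ ℝ), IsArcLengthParam ω φ (sphere 0 1) ∧ ContDiff ℝ 1 h ∧
      (∀ α, φ (h α) = polar e α) ∧
      ∀ α, deriv φ (h α) = ‖deriv (polar e) α‖⁻¹ • deriv (polar e) α := by
  have h0 : ∀ α, 0 < ‖deriv (polar e) α‖ := fun α => norm_pos_iff.2 (deriv_polar_ne_zero he hΦ α)
  have hg : Continuous fun α => ‖deriv (polar e) α‖ := (contDiff_deriv_polar hΦ).continuous.norm
  obtain ⟨φ, h, hh, hφ, hφN, hφM⟩ := exists_reparametrization hg Real.two_pi_pos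
    (fun α => by
      rw [(polar_periodic e).deriv_periodic])
    (strictMono_integral_of_pos hg h0)
    (N := polar e) (M := fun α => ‖deriv (polar e) α‖⁻¹ • deriv (polar e) α)
    (fun α => by rw [smul_inv_smul₀ (h0 α).ne']; exact hasDerivAt_polar hΦ α)
    ((hg.inv₀ fun α => (h0 α).ne').smul (contDiff_deriv_polar hΦ).continuous)
  refine ⟨φ, h, ⟨hφ, fun u => ?_, fun u => ?_, fun u => ?_⟩, hh, hφN, hφM⟩
  · rw [← h.apply_symm_apply u, hφN, mem_sphere_zero_iff_norm, norm_polar]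
  · rw [← h.apply_symm_apply u, hφM, norm_smul, norm_inv, norm_norm, inv_mul_cancel₀ (h0 _).ne']
  · rw [← h.apply_symm_apply u, hφN, hφM, map_smul, smul_eq_mul]
    exact mul_pos (inv_pos.2 (h0 _)) (form_polar_pos he hΦ _)

theorem exists_isArcLengthCurvature [CompleteSpace X] (he : IsDetCoordinate ω e)
    (hΦ : ContDiff ℝ 2 (polar e)) (hγ : IsSimpleClosedCurve γ c) :
    ∃ k, IsArcLengthCurvature ω γ k := by
  obtain ⟨φ, h, hφ, hh, hφN, -⟩ := exists_isArcLengthParam he hΦ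
  obtain ⟨θ, hθ, hT⟩ := hγ.exists_tangent_angle he
  obtain ⟨k, hk⟩ := hγ.exists_isArcLengthDeriv (hh.comp hθ)
  exact ⟨k, φ, _, hφ, fun τ => by rw [Function.comp_apply, hφN, hT], hk⟩

theorem exists_isNormalCurvature [CompleteSpace X] (he : IsDetCoordinate ω e)
    (hΦ : ContDiff ℝ 2 (polar e)) (hsc : ∀ x y : X, ‖x‖ = 1 → ‖y‖ = 1 → ‖x + y‖ = 2 → x = y)
    (hγ : IsSimpleClosedCurve γ c) : ∃ k, IsNormalCurvature ω γ k := by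
  have hNc := contDiff_polarNormal he hΦ
  have hg : Continuous fun α => ω (polarNormal ω e α) (deriv (polarNormal ω e) α) :=
    he.continuous hNc.continuous (hNc.continuous_deriv (by simp))
  obtain ⟨ψ, h, hh, hψ, hψN, hψM⟩ := exists_reparametrization hg Real.two_pi_pos
    (fun α => by
      rw [polarNormal_periodic ω e, (polarNormal_periodic ω e).deriv_periodic])
    (strictMono_integral_form_polarNormal he hΦ hsc)
    (N := polarNormal ω e) (M := fun α => -polar e α)
    (fun α => by rw [← deriv_polarNormal he hΦ]; exact hasDerivAt_polarNormal he hΦ α)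
    hΦ.continuous.neg
  obtain ⟨θ, hθ, hT⟩ := hγ.exists_tangent_angle he
  obtain ⟨k, hk⟩ := hγ.exists_isArcLengthDeriv (hh.comp hθ)
  refine ⟨k, fun τ => polarNormal ω e (θ τ), ψ, _, fun τ => ?_, ⟨hψ, fun u => ?_, fun u => ?_⟩,
    fun τ => ?_, hk⟩
  · rw [hT]
    exact ⟨birkhoffOrthogonal_of_abs_form_le he (norm_polar e _)
      (form_polar_polarNormal he hΦ _) (abs_form_polarNormal_le he hΦ _),
      form_polar_polarNormal he hΦ _⟩
  · rw [← h.apply_symm_apply u, hψN]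
    exact antiNorm_eq_one he (norm_polar e _) (form_polar_polarNormal he hΦ _)
      (abs_form_polarNormal_le he hΦ _)
  · rw [← h.apply_symm_apply u, hψN, hψM, map_neg, he.swap, neg_neg,
      form_polar_polarNormal he hΦ]
  · rw [Function.comp_apply, hψN]

/-- Whether the curvature of the unit circle vanishes does not depend on the parametrization. -/
theorem form_deriv_polar_ne_zero (he : IsDetCoordinate ω e) (hΦ : ContDiff ℝ 2 (polar e))
    {σ : ℝ → X} {l : ℝ} (hσ : IsSimpleClosedCurve σ l) (hσS : range σ = sphere (0 : X) 1)
    (h : ∀ t, ω (deriv σ t) (deriv (deriv σ) t) ≠ 0) (α : ℝ) :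
    ω (deriv (polar e) α) (deriv (deriv (polar e)) α) ≠ 0 := by
  have hn : ∀ t, ‖σ t‖ = 1 := fun t => by
    have := mem_range_self (f := σ) t
    rwa [hσS, mem_sphere_zero_iff_norm] at this
  have h0 : ∀ t, σ t ≠ 0 := fun t h => by simpa [h] using hn t
  have h2 : ((1 : ℕ) + 1 : WithTop ℕ∞) = 2 := by norm_num
  obtain ⟨θ, hθ, hσθ, -⟩ := exists_angle he (n := 1) (h2 ▸ hσ.contDiff) h0
  have hθ1 : ContDiff ℝ 1 (deriv θ) := by
    simpa using (contDiff_succ_iff_deriv.1 hθ).2.2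
  have hθd : ∀ t, HasDerivAt θ (deriv θ t) t := fun t =>
    ((hθ.differentiable (by simp)) t).hasDerivAt
  have hpol : σ = fun t => polar e (θ t) := funext fun t => by
    rw [← hσθ, hn, inv_one, one_smul]
  have hd1 : deriv σ = fun t => deriv θ t • deriv (polar e) (θ t) := funext fun t => by
    rw [hpol]
    exact ((hasDerivAt_polar hΦ (θ t)).scomp t (hθd t)).deriv
  obtain ⟨t, ht⟩ : polar e α ∈ range σ := by
    rw [hσS, mem_sphere_zero_iff_norm, norm_polar]
  have hd2 : deriv (deriv σ) t = deriv θ t • (deriv θ t • deriv (deriv (polar e)) (θ t)) +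
      deriv (deriv θ) t • deriv (polar e) (θ t) := by
    rw [hd1]
    exact ((hθ1.differentiable (by simp) t).hasDerivAt.smul
      ((((contDiff_deriv_polar hΦ).differentiable (by simp) (θ t)).hasDerivAt).scomp t
        (hθd t))).deriv
  have h3 := h t
  rw [hd2, congrFun hd1 t] at h3
  rw [hpol] at ht
  obtain ⟨m, hm⟩ := exists_int_of_polar_eq ht
  rw [hm, ((polar_periodic e).deriv_periodic.int_mul m) α,
    ((polar_periodic e).deriv_periodic.deriv_periodic.int_mul m) α] at h3
  intro h4
  apply h3
  simp [h4, he.self]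

theorem exists_isCircularCurvature [CompleteSpace X] (he : IsDetCoordinate ω e)
    (hΦ : ContDiff ℝ 2 (polar e))
    (hcurv : ∀ α, ω (deriv (polar e) α) (deriv (deriv (polar e)) α) ≠ 0)
    (hγ : IsSimpleClosedCurve γ c) : ∃ k, IsCircularCurvature ω γ k := by
  obtain ⟨φ, h, hφ, hh, -, hφM⟩ := exists_isArcLengthParam he hΦ
  obtain ⟨θ, hθ, hT⟩ := hγ.exists_tangent_angle he
  have hc1 := contDiff_deriv_polar hΦ
  obtain ⟨χ, hχ, hχp, hχd⟩ := exists_angle he (n := 0) (by simpa using hc1)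
    (deriv_polar_ne_zero he hΦ)
  have hχ1 : ContDiff ℝ 1 χ := by simpa using hχ
  have hχder : ∀ α, HasDerivAt χ (deriv χ α) α := fun α =>
    (hχ1.differentiable (by simp) α).hasDerivAt
  have hχpos : ∀ α, 0 < deriv χ α := by
    intro α
    have h1 : 0 ≤ ω (deriv (polar e) α) (deriv (deriv (polar e)) α) := by
      have hg : ContDiff ℝ 1 fun α => ω (polar e α) (deriv (polar e) α) :=
        he.contDiff (hΦ.of_le (by norm_num)) hc1
      have h2 := (hg.differentiable (by simp) α).hasDerivAt.smul (hasDerivAt_polarNormal he hΦ α)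
      have h3 : (fun α => ω (polar e α) (deriv (polar e) α)) • polarNormal ω e
          = deriv (polar e) := funext fun α => smul_polarNormal he hΦ α
      rw [h3] at h2
      have h6 : ∀ y, ω (deriv (polar e) α) y =
          ω (polar e α) (deriv (polar e) α) * ω (polarNormal ω e α) y := fun y => by
        conv_lhs => rw [← smul_polarNormal he hΦ α, map_smul, LinearMap.smul_apply, smul_eq_mul]
      rw [h2.deriv, h6, map_add, map_smul, map_smul, he.self, smul_zero, add_zero, smul_eq_mul]
      have h4 := (form_polar_pos he hΦ α).le
      exact mul_nonneg h4 (mul_nonneg h4 (form_polarNormal_nonneg he hΦ α))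
    have h5 := h1.lt_of_ne (hcurv α).symm
    rw [← hχd α] at h5
    exact pos_of_mul_pos_left h5 (by positivity)
  have hmono : StrictMono χ := strictMono_of_deriv_pos hχpos
  obtain ⟨H, hH⟩ := exists_homeomorph_of_strictMono hχ1.continuous hmono Real.two_pi_pos
    (c := 2 * Real.pi) fun α => by
      have h1 : polar e (χ (α + 2 * Real.pi)) = polar e (χ α) := by
        rw [← hχp, ← hχp, (polar_periodic e).deriv_periodic]
      obtain ⟨m, hm⟩ := exists_int_of_polar_eq h1
      have h2 := hmono (lt_add_of_pos_right α Real.two_pi_pos)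
      rw [hm] at h2 ⊢
      have h3 : (0 : ℝ) < m := pos_of_mul_pos_left (by linarith) Real.two_pi_pos.le
      have h4 : (1 : ℝ) ≤ m := by exact_mod_cast Int.add_one_le_iff.2 (Int.cast_pos.1 h3)
      have := le_mul_of_one_le_left Real.two_pi_pos.le h4
      linarith
  have hHs : ContDiff ℝ 1 H.symm := H.contDiff_symm_deriv (fun α => (hχpos α).ne')
    (fun α => by rw [hH]; exact hχder α) (by rwa [hH])
  obtain ⟨k, hk⟩ := hγ.exists_isArcLengthDeriv (hh.comp (hHs.comp hθ))
  refine ⟨k, φ, _, hφ, fun τ => ?_, hk⟩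
  rw [Function.comp_apply, hφM, hχp, ← hH, Function.comp_apply, H.apply_symm_apply, hT]

end Existence

/-! ### The curvatures as densities with vanishing first moment -/

section Closing

variable {X : Type*} [NormedAddCommGroup X] [NormedSpace ℝ X] {ω : LinearMap.BilinForm ℝ X}
  {e : X ≃L[ℝ] ℂ} {γ : ℝ → X} {c : ℝ}

theorem periodic_integral_of_antiperiodic [CompleteSpace X] {f : ℝ → X} (hf : Continuous f) {p : ℝ}
    (hp : Function.Antiperiodic f p) :
    Function.Periodic (fun x => ∫ s in (0 : ℝ)..x, f s) (2 * p) := by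
  intro x
  have hi : ∀ a b, IntervalIntegrable f MeasureTheory.volume a b := fun a b =>
    hf.intervalIntegrable a b
  have h1 : ∫ s in x + p..x + 2 * p, f s = -∫ s in x..x + p, f s := by
    rw [← intervalIntegral.integral_neg, show x + 2 * p = x + p + p by ring,
      ← intervalIntegral.integral_comp_add_right]
    exact intervalIntegral.integral_congr fun s _ => hp s
  change ∫ s in (0 : ℝ)..x + 2 * p, f s = ∫ s in (0 : ℝ)..x, f s
  rw [← intervalIntegral.integral_add_adjacent_intervals (hi 0 x) (hi x _),
    ← intervalIntegral.integral_add_adjacent_intervals (hi x (x + p)) (hi (x + p) _), h1,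
    add_neg_cancel, add_zero]

/-- Let `T = φ ∘ u` with `φ` a parametrization of the unit circle for which `du = g(α) dα` in terms
of the angle `α`, where `g` has period `π`. Then `∫ T du` vanishes along `γ`, because the unit
circle is symmetric about the origin. -/
theorem exists_periodic_primitive_of_angle [CompleteSpace X]
    (hΦ : ContDiff ℝ 2 (polar e)) (hγ : IsSimpleClosedCurve γ c) {g : ℝ → ℝ} (hg : Continuous g)
    (hgp : Function.Periodic g Real.pi) {a u k : ℝ → ℝ} (ha : ContDiff ℝ 1 a)
    (hga : ∀ x, g (a x) * deriv a x = 1) (hT : ∀ τ, unitTangent γ τ = polar e (a (u τ)))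
    (hk : IsArcLengthDeriv γ u k) :
    ∃ Γ : ℝ → X, Function.Periodic Γ c ∧ ∀ τ, HasDerivAt Γ (k τ • deriv γ τ) τ := by
  have hf : Continuous fun α => g α • polar e α := hg.smul hΦ.continuous
  have hper := periodic_integral_of_antiperiodic hf (p := Real.pi) fun α => by
    change g (α + Real.pi) • polar e (α + Real.pi) = -(g α • polar e α)
    rw [hgp, polar_add_pi, smul_neg]
  refine ⟨fun τ => ∫ s in (0 : ℝ)..a (u τ), g s • polar e s, fun τ => ?_, fun τ => ?_⟩
  · have h1 : polar e (a (u (τ + c))) = polar e (a (u τ)) := by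
      rw [← hT, ← hT, hγ.periodic_unitTangent]
    obtain ⟨m, hm⟩ := exists_int_of_polar_eq h1
    simp only [hm]
    exact (hper.int_mul m) (a (u τ))
  · have hud := (hk.1.differentiable (by simp) τ).hasDerivAt
    have had := (ha.differentiable (by simp) (u τ)).hasDerivAt
    have h1 := (hf.integral_hasStrictDerivAt 0 (a (u τ))).hasDerivAt.scomp τ (had.comp τ hud)
    refine h1.congr_deriv ?_
    rw [hk.smul_deriv hγ, smul_smul, hT]
    congr 1
    linear_combination deriv u τ * hga (u τ)

/-- A parametrization of the unit circle of class `C¹` has an angle function. -/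
theorem exists_angle_of_norm_eq_one (he : IsDetCoordinate ω e) (hΦ : ContDiff ℝ 2 (polar e))
    {φ : ℝ → X} (hφ : ContDiff ℝ 1 φ) (h1 : ∀ u, ‖φ u‖ = 1) :
    ∃ a : ℝ → ℝ, ContDiff ℝ 1 a ∧ (∀ u, φ u = polar e (a u)) ∧
      ∀ u, deriv φ u = deriv a u • deriv (polar e) (a u) := by
  obtain ⟨a, ha, hφa, -⟩ := exists_angle he (n := 0) (by simpa using hφ)
    (fun u h => by simpa [h] using h1 u)
  have ha1 : ContDiff ℝ 1 a := by simpa using ha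
  have hpol : ∀ u, φ u = polar e (a u) := fun u => by rw [← hφa, h1, inv_one, one_smul]
  refine ⟨a, ha1, hpol, fun u => ?_⟩
  rw [funext hpol]
  exact ((hasDerivAt_polar hΦ (a u)).scomp u (ha1.differentiable (by simp) u).hasDerivAt).deriv

theorem IsMinkowskiCurvature.exists_periodic_primitive [CompleteSpace X]
    (he : IsDetCoordinate ω e) (hΦ : ContDiff ℝ 2 (polar e)) (hγ : IsSimpleClosedCurve γ c)
    {k : ℝ → ℝ} (hk : IsMinkowskiCurvature ω γ k) :
    ∃ Γ : ℝ → X, Function.Periodic Γ c ∧ ∀ τ, HasDerivAt Γ (k τ • deriv γ τ) τ := by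
  obtain ⟨φ, u, hφ, hT, hk⟩ := hk
  obtain ⟨a, ha, hφa, had⟩ := exists_angle_of_norm_eq_one he hΦ hφ.contDiff
    fun u => mem_sphere_zero_iff_norm.1 (hφ.mem u)
  refine exists_periodic_primitive_of_angle hΦ hγ
    (g := fun α => ω (polar e α) (deriv (polar e) α)) (he.continuous hΦ.continuous
      (contDiff_deriv_polar hΦ).continuous) (fun α => ?_) ha (fun x => ?_)
    (fun τ => by rw [hT, hφa]) hk
  · change ω (polar e (α + Real.pi)) (deriv (polar e) (α + Real.pi)) = _
    rw [polar_add_pi, deriv_polar_add_pi, map_neg, map_neg, LinearMap.neg_apply, neg_neg]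
  · have := hφ.area x
    rwa [had, hφa, map_smul, smul_eq_mul, mul_comm] at this

theorem IsArcLengthCurvature.exists_periodic_primitive [CompleteSpace X]
    (he : IsDetCoordinate ω e) (hΦ : ContDiff ℝ 2 (polar e)) (hγ : IsSimpleClosedCurve γ c)
    {k : ℝ → ℝ} (hk : IsArcLengthCurvature ω γ k) :
    ∃ Γ : ℝ → X, Function.Periodic Γ c ∧ ∀ τ, HasDerivAt Γ (k τ • deriv γ τ) τ := by
  obtain ⟨φ, u, hφ, hT, hk⟩ := hk
  obtain ⟨a, ha, hφa, had⟩ := exists_angle_of_norm_eq_one he hΦ hφ.contDiff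
    fun u => mem_sphere_zero_iff_norm.1 (hφ.mem u)
  refine exists_periodic_primitive_of_angle hΦ hγ
    (g := fun α => ‖deriv (polar e) α‖) (contDiff_deriv_polar hΦ).continuous.norm
    (fun α => ?_) ha (fun x => ?_) (fun τ => by rw [hT, hφa]) hk
  · change ‖deriv (polar e) (α + Real.pi)‖ = _
    rw [deriv_polar_add_pi, norm_neg]
  · have h1 := hφ.unit_speed x
    have h2 := hφ.oriented x
    rw [had, hφa, map_smul, smul_eq_mul] at h2
    have h3 := pos_of_mul_pos_left h2 (form_polar_pos he hΦ _).le
    rwa [had, norm_smul, Real.norm_of_nonneg h3.le, mul_comm] at h1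

/-- The derivative of the right normal field with respect to arc length is `-k_n T`. -/
theorem IsNormalCurvature.exists_periodic_primitive
    (he : IsDetCoordinate ω e) (hΦ : ContDiff ℝ 2 (polar e)) (hγ : IsSimpleClosedCurve γ c)
    {k : ℝ → ℝ} (hk : IsNormalCurvature ω γ k) :
    ∃ Γ : ℝ → X, Function.Periodic Γ c ∧ ∀ τ, HasDerivAt Γ (k τ • deriv γ τ) τ := by
  obtain ⟨n, ψ, v, hn, hψ, hnv, hk⟩ := hk
  obtain ⟨θ, -, hT⟩ := hγ.exists_tangent_angle he
  have hnN : ∀ τ, ∀ α, unitTangent γ τ = polar e α → n τ = polarNormal ω e α := by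
    intro τ α h
    have := hn τ
    rw [h] at this
    exact eq_polarNormal he hΦ this.1 this.2
  refine ⟨fun τ => -n τ, fun τ => ?_, fun τ => ?_⟩
  · change -n (τ + c) = -n τ
    rw [hnN τ _ (hT τ), hnN (τ + c) _ ((hγ.periodic_unitTangent τ).trans (hT τ))]
  · have hvd := (hk.1.differentiable (by simp) τ).hasDerivAt
    have hψd := (hψ.contDiff.differentiable (by simp) (v τ)).hasDerivAt
    -- `ω T` attains its maximum over the anti-circle at the right normal
    have hmax : IsLocalMax (fun s => ω (unitTangent γ τ) (ψ s)) (v τ) :=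
      Filter.Eventually.of_forall fun s => by
        change ω (unitTangent γ τ) (ψ s) ≤ ω (unitTangent γ τ) (ψ (v τ))
        rw [← hnv, (hn τ).2, he.swap]
        exact (neg_le_abs _).trans
          (abs_form_le_one_of_antiNorm_eq_one (hψ.mem s) (hγ.norm_unitTangent τ))
    have h1 := hmax.hasDerivAt_eq_zero (he.hasDerivAt_right hψd _)
    have h2 := he.cramer (unitTangent γ τ) (n τ) (deriv ψ (v τ))
    have h3 := hψ.area (v τ)
    rw [← hnv] at h3
    rw [(hn τ).2, h1, zero_smul, add_zero, one_smul, he.swap, h3] at h2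
    have h4 := (hψd.scomp τ hvd).neg
    rw [h2] at h4
    have h5 : (fun τ => -n τ) = -(ψ ∘ v) := funext fun τ => by simp [hnv]
    rw [h5]
    refine h4.congr_deriv ?_
    rw [hk.smul_deriv hγ]
    simp

/-- The point of the unit circle with tangent `T` has derivative `k_c T` with respect to arc
length. -/
theorem IsCircularCurvature.exists_periodic_primitive
    (he : IsDetCoordinate ω e)
    (hsc : ∀ x y : X, ‖x‖ = 1 → ‖y‖ = 1 → ‖x + y‖ = 2 → x = y) (hγ : IsSimpleClosedCurve γ c)
    {k : ℝ → ℝ} (hk : IsCircularCurvature ω γ k) :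
    ∃ Γ : ℝ → X, Function.Periodic Γ c ∧ ∀ τ, HasDerivAt Γ (k τ • deriv γ τ) τ := by
  obtain ⟨φ, t, hφ, hT, hk⟩ := hk
  have hn : ∀ s, ‖φ s‖ = 1 := fun s => mem_sphere_zero_iff_norm.1 (hφ.mem s)
  have hd : ∀ τ, HasDerivAt φ (unitTangent γ τ) (t τ) := fun τ => by
    rw [hT]
    exact (hφ.contDiff.differentiable (by simp) (t τ)).hasDerivAt
  have hpos : ∀ τ, 0 < ω (φ (t τ)) (unitTangent γ τ) := fun τ => by
    rw [hT]
    exact hφ.oriented _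
  refine ⟨fun τ => φ (t τ), fun τ => ?_, fun τ => ?_⟩
  · have h1 := hd (τ + c)
    have h2 := hpos (τ + c)
    rw [hγ.periodic_unitTangent] at h1 h2
    exact eq_of_tangent_eq he hsc hn hn h1 (hd τ) h2 (hpos τ)
  · rw [hk.smul_deriv hγ]
    exact (hd τ).scomp τ (hk.1.differentiable (by simp) τ).hasDerivAt

end Closing

/-! ### Strictly monotone densities -/

section Arcs

/-- Integration by parts for a merely continuous, strictly decreasing weight: if `F` vanishes at
`p` and `q` and is positive in between, then `∫ k F'` over `[p, q]` is positive. Here `G` is a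
primitive of `k F'`. -/
theorem lt_of_hasDerivAt_mul_of_strictAntiOn {k F F' G : ℝ → ℝ} {p q : ℝ} (hpq : p < q)
    (hk : StrictAntiOn k (Icc p q)) (hkc : Continuous k) (hF : ∀ x, HasDerivAt F (F' x) x)
    (hF' : Continuous F') (hG : ∀ x, HasDerivAt G (k x * F' x) x)
    (hpos : ∀ x ∈ Ioo p q, 0 < F x) (hp : F p = 0) (hq : F q = 0) : G p < G q := by
  have hFc : Continuous F := continuous_iff_continuousAt.2 fun x => (hF x).continuousAt
  have hGc : Continuous G := continuous_iff_continuousAt.2 fun x => (hG x).continuousAt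
  obtain ⟨M, hM⟩ := isCompact_Icc.exists_bound_of_continuousOn (s := Icc p q) hF'.continuousOn
  have hM0 : 0 ≤ M := (norm_nonneg _).trans (hM p ⟨le_rfl, hpq.le⟩)
  set Ψ : ℝ → ℝ := fun x => G x - k x * F x with hΨ
  have hΨc : Continuous Ψ := hGc.sub (hkc.mul hFc)
  -- formally `dΨ = -F dk ≥ 0`; the estimate is a discrete form of this
  have hest : ∀ x ∈ Icc p q, ∀ y ∈ Icc p q, x ≤ y →
      (k x - k y) * (F x - M * (y - x)) ≤ Ψ y - Ψ x := by
    intro x hx y hy hxy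
    have hsub : Icc x y ⊆ Icc p q := Icc_subset_Icc hx.1 hy.2
    have h1 := (convex_Icc x y).norm_image_sub_le_of_norm_hasDerivWithin_le
      (f := fun s => G s - k y * F s) (f' := fun s => k s * F' s - k y * F' s)
      (C := (k x - k y) * M)
      (fun s _ => ((hG s).sub ((hF s).const_mul (k y))).hasDerivWithinAt) (fun s hs => by
        have h2 := hk.antitoneOn (hsub ⟨le_rfl, hxy⟩) (hsub hs) hs.1
        have h3 := hk.antitoneOn (hsub hs) (hsub ⟨hxy, le_rfl⟩) hs.2
        rw [← sub_mul, norm_mul, Real.norm_of_nonneg (sub_nonneg.2 h3)]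
        exact mul_le_mul (by linarith) (hM s (hsub hs)) (norm_nonneg _) (by linarith))
      (left_mem_Icc.2 hxy) (right_mem_Icc.2 hxy)
    rw [Real.norm_eq_abs, Real.norm_of_nonneg (sub_nonneg.2 hxy)] at h1
    have h4 := neg_le_of_abs_le h1
    simp only [hΨ]
    linarith
  have hinc : ∀ x ∈ Ioo p q, ∀ b ∈ Ioc x q, ∃ y ∈ Ioc x b, Ψ x < Ψ y := by
    intro x hx b hb
    have hFx := hpos x hx
    have hM1 : 0 < M + 1 := by linarith
    set y := min b (x + F x / (M + 1)) with hy
    have hxy : x < y := lt_min hb.1 (by linarith [div_pos hFx hM1])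
    have hyb : y ≤ b := min_le_left _ _
    refine ⟨y, ⟨hxy, hyb⟩, ?_⟩
    have hxm : x ∈ Icc p q := Ioo_subset_Icc_self hx
    have hym : y ∈ Icc p q := ⟨hx.1.le.trans hxy.le, hyb.trans hb.2⟩
    have h1 := hest x hxm y hym hxy.le
    have h2 : (M + 1) * (y - x) ≤ F x := by
      have : y - x ≤ F x / (M + 1) := by linarith [min_le_right b (x + F x / (M + 1))]
      rwa [le_div_iff₀ hM1, mul_comm] at this
    have h3 : 0 < F x - M * (y - x) := by linarith
    have h4 := mul_pos (sub_pos.2 (hk hxm hym hxy)) h3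
    linarith
  have hlt : ∀ a ∈ Ioo p q, ∀ b ∈ Ioc a q, Ψ a < Ψ b := by
    intro a ha b hb
    obtain ⟨x, hx, hmax⟩ := isCompact_Icc.exists_isMaxOn ⟨a, left_mem_Icc.2 hb.1.le⟩
      hΨc.continuousOn
    have hxb : x = b := by
      by_contra hne
      have hlt : x < b := lt_of_le_of_ne hx.2 hne
      obtain ⟨y, hy, hxy⟩ := hinc x ⟨ha.1.trans_le hx.1, hlt.trans_le hb.2⟩ b ⟨hlt, hb.2⟩
      exact absurd (hmax ⟨hx.1.trans hy.1.le, hy.2⟩) (not_le.2 hxy)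
    subst hxb
    obtain ⟨y, hy, hxy⟩ := hinc a ha x hb
    exact hxy.trans_le (hmax ⟨hy.1.le, hy.2⟩)
  obtain ⟨m, hm⟩ := exists_between hpq
  have h1 : Ψ m < Ψ q := hlt m hm q ⟨hm.2, le_rfl⟩
  have h2 : Ψ p ≤ Ψ m := by
    refine le_of_tendsto (hΨc.continuousWithinAt (s := Ioi p) (x := p)).tendsto ?_
    filter_upwards [Ioo_mem_nhdsGT hm.1] with a ha
    exact (hlt a ⟨ha.1, ha.2.trans hm.2⟩ m ⟨ha.2, hm.2.le⟩).le
  have := h2.trans_lt h1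
  simpa [hΨ, hp, hq] using this

theorem injOn_of_forall_not_isLocalExtr {k : ℝ → ℝ} (hk : Continuous k) {a b : ℝ}
    (h : ∀ x ∈ Ioo a b, ¬IsLocalExtr k x) : InjOn k (Icc a b) := by
  have key : ∀ x ∈ Icc a b, ∀ y ∈ Icc a b, x < y → k x ≠ k y := by
    intro x hx y hy hxy heq
    obtain ⟨z, hz, hze⟩ := exists_isLocalExtr_Ioo hxy hk.continuousOn heq
    exact h z ⟨hx.1.trans_lt hz.1, hz.2.trans_le hy.2⟩ hze
  intro x hx y hy heq
  by_contra hne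
  rcases lt_or_gt_of_ne hne with hlt | hlt
  · exact key x hx y hy hlt heq
  · exact key y hy x hx hlt heq.symm

/-- A continuous function is strictly decreasing from a maximum to a minimum if there is at most one
local extremum in between: a single one could only be a point of monotonicity. -/
theorem strictAntiOn_of_subsingleton_isLocalExtr {k : ℝ → ℝ} (hk : Continuous k) {a b : ℝ}
    (hab : a ≤ b) (ha : ∀ x, k x ≤ k a) (hb : ∀ x, k b ≤ k x)
    (h : {x | x ∈ Ioo a b ∧ IsLocalExtr k x}.Subsingleton) : StrictAntiOn k (Icc a b) := by
  by_cases hr : ∃ r ∈ Ioo a b, IsLocalExtr k r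
  · obtain ⟨r, hr, hre⟩ := hr
    have h1 : StrictAntiOn k (Icc a r) :=
      ContinuousOn.strictAntiOn_of_injOn_Icc hr.1.le (ha r) hk.continuousOn
        (injOn_of_forall_not_isLocalExtr hk fun x hx hxe =>
          hx.2.ne (h ⟨⟨hx.1, hx.2.trans hr.2⟩, hxe⟩ ⟨hr, hre⟩))
    have h2 : StrictAntiOn k (Icc r b) :=
      ContinuousOn.strictAntiOn_of_injOn_Icc hr.2.le (hb r) hk.continuousOn
        (injOn_of_forall_not_isLocalExtr hk fun x hx hxe =>
          hx.1.ne' (h ⟨⟨hr.1.trans hx.1, hx.2⟩, hxe⟩ ⟨hr, hre⟩))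
    rw [← Icc_union_Icc_eq_Icc hr.1.le hr.2.le]
    exact h1.union h2 (isGreatest_Icc hr.1.le) (isLeast_Icc hr.2.le)
  · push Not at hr
    exact ContinuousOn.strictAntiOn_of_injOn_Icc hab (ha b) hk.continuousOn
      (injOn_of_forall_not_isLocalExtr hk hr)

end Arcs

/-! ### Chords of a strictly convex curve -/

section Chord

variable {X : Type*} [NormedAddCommGroup X] [NormedSpace ℝ X] {ω : LinearMap.BilinForm ℝ X}
  {e : X ≃L[ℝ] ℂ} {γ : ℝ → X} {c : ℝ}

theorem IsSimpleClosedCurve.eq_of_abs_sub_lt (hγ : IsSimpleClosedCurve γ c) {x y : ℝ}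
    (h : γ x = γ y) (hxy : |x - y| < c) : x = y := by
  have hc := hγ.period_pos
  have key : ∀ z, γ (toIcoMod hc 0 z) = γ z := fun z => hγ.periodic.sub_zsmul_eq _
  have mem : ∀ z, toIcoMod hc 0 z ∈ Ico 0 c := fun z => by
    simpa using toIcoMod_mem_Ico hc 0 z
  have h1 := hγ.injOn (mem x) (mem y) ((key x).trans (h.trans (key y).symm))
  rw [toIcoMod, toIcoMod, zsmul_eq_mul, zsmul_eq_mul] at h1
  set m := toIcoDiv hc 0 x
  set n := toIcoDiv hc 0 y
  have h2 : x - y = ((m - n : ℤ) : ℝ) * c := by push_cast; linarith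
  rw [h2, abs_mul, abs_of_pos hc, ← Int.cast_abs] at hxy
  have h3 : ((|m - n| : ℤ) : ℝ) < 1 := lt_of_mul_lt_mul_right (by rwa [one_mul]) hc.le
  have h4 : m - n = 0 := Int.abs_lt_one_iff.1 (by exact_mod_cast h3)
  rw [h4, Int.cast_zero, zero_mul] at h2
  exact sub_eq_zero.1 h2

/-- A line meets a strictly convex curve in at most two points. -/
theorem IsStrictlyConvexCurve.form_chord_ne_zero (hγ : IsStrictlyConvexCurve γ c)
    (he : IsDetCoordinate ω e) {p q r : ℝ} (hpq : γ p ≠ γ q) (hrp : γ r ≠ γ p) (hrq : γ r ≠ γ q) :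
    ω (γ r - γ p) (γ q - γ p) ≠ 0 := by
  intro h0
  obtain ⟨K, hKc, hK, hKγ⟩ := hγ.bounds
  have mem : ∀ t, γ t ∈ K := fun t =>
    hKc.isClosed.frontier_subset (hKγ ▸ mem_range_self t)
  have not_mem : ∀ t, γ t ∉ interior K := fun t => by
    have : γ t ∈ frontier K := hKγ ▸ mem_range_self t
    exact this.2
  have hd : γ q - γ p ≠ 0 := sub_ne_zero.2 hpq.symm
  rw [he.swap, neg_eq_zero] at h0
  obtain ⟨s, hs⟩ := he.exists_smul_of_eq_zero hd h0
  have hr : γ r = γ p + s • (γ q - γ p) := by rw [← hs]; abel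
  have hs0 : s ≠ 0 := fun h => hrp (by rw [hr, h, zero_smul, add_zero])
  have hs1 : s ≠ 1 := fun h => hrq (by rw [hr, h, one_smul]; abel)
  rcases lt_or_gt_of_ne hs0 with h | h
  · refine not_mem p ?_
    have h1 : 0 < 1 - s := by linarith
    convert hK (mem r) (mem q) hrq (a := 1 / (1 - s)) (b := -s / (1 - s)) (by positivity)
      (div_pos (by linarith) h1) (by field_simp; ring) using 1
    rw [hr]
    match_scalars <;> field_simp <;> ring
  · rcases lt_or_gt_of_ne hs1 with h' | h'
    · refine not_mem r ?_
      convert hK (mem p) (mem q) hpq (a := 1 - s) (b := s) (by linarith) h (by ring) using 1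
      rw [hr]
      module
    · refine not_mem q ?_
      convert hK (mem p) (mem r) hrp.symm (a := (s - 1) / s) (b := 1 / s)
        (div_pos (by linarith) h) (by positivity) (by field_simp; ring) using 1
      rw [hr]
      match_scalars <;> field_simp; ring

theorem inter_frontier_nonempty_of_isPreconnected {Y : Type*} [TopologicalSpace Y] {t s : Set Y}
    (ht : IsPreconnected t) (hs : IsClosed s) (h1 : (t ∩ interior s).Nonempty)
    (h2 : (t ∩ sᶜ).Nonempty) : (t ∩ frontier s).Nonempty := by
  by_contra hcon
  obtain ⟨x, -, hx, hx'⟩ := ht (interior s) sᶜ isOpen_interior hs.isOpen_compl (fun x hx => by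
    by_cases hxs : x ∈ s
    · refine Or.inl (by_contra fun hxi => hcon ⟨x, hx, subset_closure hxs, hxi⟩)
    · exact Or.inr hxs) h1 h2
  exact hx' (interior_subset hx)

/-- A strictly convex curve has points on both sides of each of its chords: from the midpoint of the
chord, which is interior, one reaches the curve in every direction `w`. -/
theorem IsStrictlyConvexCurve.exists_form_chord_pos (hγ : IsStrictlyConvexCurve γ c)
    (he : IsDetCoordinate ω e) {p q : ℝ} (hpq : γ p ≠ γ q) {w : X} (hw : w ≠ 0) :
    ∃ s > 0, ∃ r, ω (γ r - γ p) (γ q - γ p) = s * ω w (γ q - γ p) := by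
  obtain ⟨K, hKc, hK, hKγ⟩ := hγ.bounds
  have mem : ∀ t, γ t ∈ K := fun t =>
    hKc.isClosed.frontier_subset (hKγ ▸ mem_range_self t)
  set m : X := (1 / 2 : ℝ) • γ p + (1 / 2 : ℝ) • γ q with hm
  have hmK : m ∈ interior K := hK (mem p) (mem q) hpq (by norm_num) (by norm_num) (by norm_num)
  obtain ⟨R, hR⟩ := hKc.isBounded.exists_norm_le
  have hw0 : 0 < ‖w‖ := norm_pos_iff.2 hw
  have hR0 : 0 ≤ R := (norm_nonneg _).trans (hR m (interior_subset hmK))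
  set t : Set X := (fun s : ℝ => m + s • w) '' Ici 0 with ht
  have htc : IsPreconnected t := isPreconnected_Ici.image _ (by fun_prop)
  obtain ⟨_, ⟨s, hs, rfl⟩, hsK⟩ :=
      inter_frontier_nonempty_of_isPreconnected htc hKc.isClosed
      ⟨m, ⟨0, self_mem_Ici, by simp⟩, hmK⟩ (by
      refine ⟨_, ⟨(R + ‖m‖ + 1) / ‖w‖, mem_Ici.2 (by positivity), rfl⟩, fun hmem => ?_⟩
      have h1 := hR _ hmem
      have h2 := norm_sub_le (m + ((R + ‖m‖ + 1) / ‖w‖) • w) m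
      rw [add_sub_cancel_left, norm_smul, Real.norm_of_nonneg (by positivity),
        div_mul_cancel₀ _ hw0.ne'] at h2
      change ‖m + ((R + ‖m‖ + 1) / ‖w‖) • w‖ ≤ R at h1
      linarith)
  have hs0 : s ≠ 0 := by
    rintro rfl
    simp only [zero_smul, add_zero] at hsK
    exact hsK.2 hmK
  rw [hKγ] at hsK
  obtain ⟨r, hr⟩ := hsK
  refine ⟨s, lt_of_le_of_ne hs hs0.symm, r, ?_⟩
  have h1 : γ r - γ p = (1 / 2 : ℝ) • (γ q - γ p) + s • w := by
    rw [hr, hm]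
    module
  rw [h1, map_add, map_smul, map_smul, LinearMap.add_apply, LinearMap.smul_apply,
    LinearMap.smul_apply, he.self, smul_zero, zero_add, smul_eq_mul]

/-- The two arcs of a strictly convex curve between `γ p` and `γ q` lie strictly on different sides
of the chord. -/
theorem IsStrictlyConvexCurve.arcs_separated (hγ : IsStrictlyConvexCurve γ c)
    (he : IsDetCoordinate ω e) {p q : ℝ} (hpq : p < q) (hqp : q < p + c) :
    ((∀ r ∈ Ioo p q, 0 < ω (γ r - γ p) (γ q - γ p)) ∧
        ∀ r ∈ Ioo q (p + c), ω (γ r - γ p) (γ q - γ p) < 0) ∨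
      ((∀ r ∈ Ioo p q, ω (γ r - γ p) (γ q - γ p) < 0) ∧
        ∀ r ∈ Ioo q (p + c), 0 < ω (γ r - γ p) (γ q - γ p)) := by
  have hγ' := hγ.toIsSimpleClosedCurve
  have inj : ∀ {x y : ℝ}, x < y → y < x + c → γ x ≠ γ y := fun {x y} h1 h2 h3 =>
    h1.ne (hγ'.eq_of_abs_sub_lt h3 (by rw [abs_sub_comm, abs_of_pos] <;> linarith))
  set F : ℝ → ℝ := fun r => ω (γ r - γ p) (γ q - γ p) with hF
  have hFc : Continuous F :=
    he.continuous (hγ.contDiff.continuous.sub continuous_const) continuous_const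
  have hFper : Function.Periodic F c := fun r => by simp only [hF, hγ.periodic r]
  have hFp : F p = 0 := by simp [hF]
  have hFq : F q = 0 := by simp only [hF, he.self]
  have h1 : ∀ r ∈ Ioo p q, F r ≠ 0 := fun r hr =>
    hγ.form_chord_ne_zero he (inj hpq hqp) (inj hr.1 (hr.2.trans hqp)).symm
      (inj hr.2 (by linarith [hr.1]))
  have h2 : ∀ r ∈ Ioo q (p + c), F r ≠ 0 := fun r hr =>
    hγ.form_chord_ne_zero he (inj hpq hqp) (inj (hpq.trans hr.1) hr.2).symm
      (inj hr.1 (by linarith [hr.2])).symm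
  have sign : ∀ {a b : ℝ}, (∀ r ∈ Ioo a b, F r ≠ 0) →
      (∀ r ∈ Ioo a b, 0 < F r) ∨ ∀ r ∈ Ioo a b, F r < 0 := by
    intro a b h
    by_contra! hcon
    obtain ⟨⟨x, hx, hx'⟩, y, hy, hy'⟩ := hcon
    obtain ⟨z, hz, hz0⟩ := isPreconnected_Ioo.intermediate_value hx hy hFc.continuousOn ⟨hx', hy'⟩
    exact h z hz hz0
  have ex : ∀ r, F r ≠ 0 → (∃ x ∈ Ioo p q, F x = F r) ∨ ∃ x ∈ Ioo q (p + c), F x = F r := by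
    intro r hr
    obtain ⟨x, hx, hxr⟩ := hFper.exists_mem_Ico hγ.period_pos r p
    rw [hxr] at hr ⊢
    have hxp : p < x := lt_of_le_of_ne hx.1 fun h => hr (h ▸ hFp)
    rcases lt_trichotomy x q with h | h | h
    · exact Or.inl ⟨x, ⟨hxp, h⟩, rfl⟩
    · exact absurd (h ▸ hFq) hr
    · exact Or.inr ⟨x, ⟨h, hx.2⟩, rfl⟩
  have hd : γ q - γ p ≠ 0 := sub_ne_zero.2 (inj hpq hqp).symm
  obtain ⟨w, hw⟩ : ∃ w, 0 < ω w (γ q - γ p) := by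
    by_contra! hcon
    have hall : ∀ w, ω (γ q - γ p) w = 0 := fun w => by
      have h3 := hcon w
      have h4 := hcon (-w)
      rw [map_neg, LinearMap.neg_apply] at h4
      rw [he.swap]
      linarith
    obtain ⟨a, ha⟩ := he.exists_smul_of_eq_zero hd (hall (e.symm (Complex.I * e (γ q - γ p))))
    have hz : e (γ q - γ p) ≠ 0 := (map_ne_zero_iff e e.injective).2 hd
    have h5 := congrArg e ha
    rw [e.apply_symm_apply, map_smul, Complex.real_smul] at h5
    simpa using congrArg Complex.im (mul_right_cancel₀ hz h5)
  have hw0 : w ≠ 0 := fun h => by simp [h] at hw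
  obtain ⟨s, hs, r₁, hr₁⟩ := hγ.exists_form_chord_pos he (inj hpq hqp) hw0
  obtain ⟨s', hs', r₂, hr₂⟩ := hγ.exists_form_chord_pos he (inj hpq hqp) (neg_ne_zero.2 hw0)
  have hF₁ : 0 < F r₁ := by
    change 0 < ω (γ r₁ - γ p) (γ q - γ p)
    rw [hr₁]
    positivity
  have hF₂ : F r₂ < 0 := by
    change ω (γ r₂ - γ p) (γ q - γ p) < 0
    rw [hr₂, map_neg, LinearMap.neg_apply, mul_neg]
    exact neg_neg_of_pos (by positivity)
  rcases sign h1 with h1 | h1 <;> rcases sign h2 with h2 | h2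
  · rcases ex r₂ hF₂.ne with ⟨x, hx, hxr⟩ | ⟨x, hx, hxr⟩
    · linarith [h1 x hx]
    · linarith [h2 x hx]
  · exact Or.inl ⟨h1, h2⟩
  · exact Or.inr ⟨h1, h2⟩
  · rcases ex r₁ hF₁.ne' with ⟨x, hx, hxr⟩ | ⟨x, hx, hxr⟩
    · linarith [h1 x hx]
    · linarith [h2 x hx]

end Chord

/-! ### The four vertex argument -/

section FourVertex

variable {X : Type*} [NormedAddCommGroup X] [NormedSpace ℝ X] {ω : LinearMap.BilinForm ℝ X}
  {e : X ≃L[ℝ] ℂ} {γ : ℝ → X} {c : ℝ}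

theorem four_le_encard_of_ne {α : Type*} {s : Set α} {a b c d : α} (ha : a ∈ s) (hb : b ∈ s)
    (hc : c ∈ s) (hd : d ∈ s) (hab : a ≠ b) (hac : a ≠ c) (had : a ≠ d) (hbc : b ≠ c) (hbd : b ≠ d)
    (hcd : c ≠ d) : 4 ≤ s.encard := by
  have h : ({a, b, c, d} : Set α).encard = 4 := by
    rw [encard_insert_of_notMem (by simp [hab, hac, had]),
      encard_insert_of_notMem (by simp [hbc, hbd]), encard_pair hcd]
    norm_num
  rw [← h]
  refine encard_le_encard ?_
  rintro x (rfl | rfl | rfl | rfl) <;> assumption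

theorem HasFourLocalExtrema.neg {k : ℝ → ℝ} (h : HasFourLocalExtrema c fun x => -k x) :
    HasFourLocalExtrema c k := by
  refine h.trans (encard_le_encard fun x hx => ⟨hx.1, ?_⟩)
  simpa using hx.2.neg

/-- The four vertex argument when the maximum of `k` comes before the minimum. -/
theorem IsStrictlyConvexCurve.hasFourLocalExtrema_of_lt (hγ : IsStrictlyConvexCurve γ c)
    (he : IsDetCoordinate ω e) {k : ℝ → ℝ} (hk : Continuous k) (hkp : Function.Periodic k c)
    {Γ : ℝ → X} (hΓ : Function.Periodic Γ c) (hΓd : ∀ τ, HasDerivAt Γ (k τ • deriv γ τ) τ)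
    {p q : ℝ} (hp : p ∈ Ico 0 c) (hq : q ∈ Ico 0 c) (hpq : p < q) (hmax : ∀ x, k x ≤ k p)
    (hmin : ∀ x, k q ≤ k x) : HasFourLocalExtrema c k := by
  by_contra hcon
  have hpE : IsLocalExtr k p := Or.inr (Filter.Eventually.of_forall hmax)
  have hqE : IsLocalExtr k q := Or.inl (Filter.Eventually.of_forall hmin)
  have hqp : q < p + c := by linarith [hp.1, hq.2]
  have h1 : {x | x ∈ Ioo p q ∧ IsLocalExtr k x}.Subsingleton := by
    intro x hx y hy
    by_contra hne
    exact hcon (four_le_encard_of_ne (s := {τ | τ ∈ Ico 0 c ∧ IsLocalExtr k τ}) ⟨hp, hpE⟩ ⟨hq, hqE⟩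
      ⟨⟨hp.1.trans hx.1.1.le, hx.1.2.trans hq.2⟩, hx.2⟩
      ⟨⟨hp.1.trans hy.1.1.le, hy.1.2.trans hq.2⟩, hy.2⟩ hpq.ne hx.1.1.ne hy.1.1.ne hx.1.2.ne'
      hy.1.2.ne' hne)
  have shift : ∀ x ∈ Ioo q (p + c), IsLocalExtr k x →
      ∃ y ∈ Ico 0 c, IsLocalExtr k y ∧ p ≠ y ∧ q ≠ y ∧ (y = x ∨ y = x - c) := by
    intro x hx hxE
    rcases lt_or_ge x c with h | h
    · exact ⟨x, ⟨hq.1.trans hx.1.le, h⟩, hxE, (hpq.trans hx.1).ne, hx.1.ne, Or.inl rfl⟩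
    · refine ⟨x - c, ⟨by linarith, by linarith [hx.2, hp.2]⟩, ?_, ?_, ?_, Or.inr rfl⟩
      rotate_left
      · exact ne_of_gt (by linarith [hx.2])
      · exact ne_of_gt (by linarith [hx.2, hp.2])
      have h3 : IsLocalExtr (k ∘ fun y => y + c) (x - c) :=
        IsLocalExtr.comp_continuous (by rwa [sub_add_cancel]) (by fun_prop)
      rwa [show k ∘ (fun y => y + c) = k from funext hkp] at h3
  have h2 : {x | x ∈ Ioo q (p + c) ∧ IsLocalExtr k x}.Subsingleton := by
    intro x hx y hy
    by_contra hne
    obtain ⟨x', hx', hxE, hxp, hxq, hxx⟩ := shift x hx.1 hx.2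
    obtain ⟨y', hy', hyE, hyp, hyq, hyy⟩ := shift y hy.1 hy.2
    refine hcon (four_le_encard_of_ne (s := {τ | τ ∈ Ico 0 c ∧ IsLocalExtr k τ}) ⟨hp, hpE⟩ ⟨hq, hqE⟩
      ⟨hx', hxE⟩ ⟨hy', hyE⟩ hpq.ne hxp hyp hxq hyq fun h => hne ?_)
    obtain ⟨⟨hx1, hx2⟩, -⟩ := hx
    obtain ⟨⟨hy1, hy2⟩, -⟩ := hy
    rcases hxx with hxx | hxx <;> rcases hyy with hyy | hyy <;> linarith
  have hanti : StrictAntiOn k (Icc p q) :=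
    strictAntiOn_of_subsingleton_isLocalExtr hk hpq.le hmax hmin h1
  have hanti' : StrictAntiOn (fun x => -k x) (Icc q (p + c)) := by
    refine strictAntiOn_of_subsingleton_isLocalExtr hk.neg hqp.le (fun x => neg_le_neg (hmin x))
      (fun x => neg_le_neg (by rw [hkp]; exact hmax x)) fun x hx y hy => ?_
    exact h2 ⟨hx.1, by simpa using hx.2.neg⟩ ⟨hy.1, by simpa using hy.2.neg⟩
  have hγd := hγ.toIsSimpleClosedCurve.hasDerivAt
  set d := γ q - γ p with hd
  set F : ℝ → ℝ := fun r => ω (γ r - γ p) d with hF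
  set G : ℝ → ℝ := fun r => ω (Γ r) d with hG
  have hFd : ∀ τ, HasDerivAt F (ω (deriv γ τ) d) τ := fun τ =>
    he.hasDerivAt_left ((hγd τ).sub_const _) d
  have hF'c : Continuous fun τ => ω (deriv γ τ) d :=
    he.continuous (hγ.contDiff.continuous_deriv (by norm_num)) continuous_const
  have hGd : ∀ τ, HasDerivAt G (k τ * ω (deriv γ τ) d) τ := fun τ => by
    simpa using he.hasDerivAt_left (hΓd τ) d
  have hFp : F p = 0 := by simp [hF]
  have hFq : F q = 0 := by simp only [hF, hd, he.self]
  have hFc : F (p + c) = 0 := by simp only [hF, hγ.periodic p]; exact hFp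
  have hGp : G (p + c) = G p := by simp only [hG, hΓ p]
  rcases hγ.arcs_separated he hpq hqp with ⟨h3, h4⟩ | ⟨h3, h4⟩
  · have h5 : G p < G q :=
      lt_of_hasDerivAt_mul_of_strictAntiOn hpq hanti hk hFd hF'c hGd h3 hFp hFq
    have h6 : G q < G (p + c) :=
      lt_of_hasDerivAt_mul_of_strictAntiOn (F := fun x => -F x) hqp hanti' hk.neg
        (fun x => (hFd x).neg) hF'c.neg (fun x => (hGd x).congr_deriv (by ring))
        (fun x hx => neg_pos.2 (h4 x hx)) (by simp [hFq]) (by simp [hFc])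
    linarith
  · have h5 : -G p < -G q :=
      lt_of_hasDerivAt_mul_of_strictAntiOn (F := fun x => -F x) (G := fun x => -G x) hpq hanti hk
        (fun x => (hFd x).neg) hF'c.neg (fun x => (hGd x).neg.congr_deriv (by ring))
        (fun x hx => neg_pos.2 (h3 x hx)) (by simp [hFp]) (by simp [hFq])
    have h6 : -G q < -G (p + c) :=
      lt_of_hasDerivAt_mul_of_strictAntiOn (G := fun x => -G x) hqp hanti' hk.neg
        hFd hF'c (fun x => (hGd x).neg.congr_deriv (by ring)) h4 hFq hFc
    linarith

/-- A continuous density `k` along a strictly convex closed curve with `∫ k dγ = 0` has at least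
four local extrema. -/
theorem IsStrictlyConvexCurve.hasFourLocalExtrema (hγ : IsStrictlyConvexCurve γ c)
    (he : IsDetCoordinate ω e) {k : ℝ → ℝ} (hk : Continuous k)
    (h : ∃ Γ : ℝ → X, Function.Periodic Γ c ∧ ∀ τ, HasDerivAt Γ (k τ • deriv γ τ) τ) :
    HasFourLocalExtrema c k := by
  obtain ⟨Γ, hΓ, hΓd⟩ := h
  have hc := hγ.period_pos
  have hkp : Function.Periodic k c := fun τ => by
    have h1 := hΓ.deriv_periodic τ
    rw [(hΓd _).deriv, (hΓd _).deriv, hγ.periodic.deriv_periodic τ] at h1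
    exact smul_left_injective ℝ (hγ.regular τ) h1
  obtain ⟨p₀, -, hp₀⟩ := isCompact_Icc.exists_isMaxOn ⟨0, left_mem_Icc.2 hc.le⟩
    (hk.continuousOn (s := Icc 0 c))
  obtain ⟨q₀, -, hq₀⟩ := isCompact_Icc.exists_isMinOn ⟨0, left_mem_Icc.2 hc.le⟩
    (hk.continuousOn (s := Icc 0 c))
  obtain ⟨p, hp, hpp⟩ := hkp.exists_mem_Ico₀ hc p₀
  obtain ⟨q, hq, hqq⟩ := hkp.exists_mem_Ico₀ hc q₀
  have hmax : ∀ x, k x ≤ k p := fun x => by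
    obtain ⟨y, hy, hxy⟩ := hkp.exists_mem_Ico₀ hc x
    rw [hxy, ← hpp]
    exact hp₀ (Ico_subset_Icc_self hy)
  have hmin : ∀ x, k q ≤ k x := fun x => by
    obtain ⟨y, hy, hxy⟩ := hkp.exists_mem_Ico₀ hc x
    rw [hxy, ← hqq]
    exact hq₀ (Ico_subset_Icc_self hy)
  rcases lt_trichotomy p q with hlt | heq | hlt
  · exact hγ.hasFourLocalExtrema_of_lt he hk hkp hΓ hΓd hp hq hlt hmax hmin
  · -- `k` is constant, so every parameter is a local extremum
    have hall : Ico 0 c ⊆ {τ | τ ∈ Ico 0 c ∧ IsLocalExtr k τ} := fun x hx =>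
      ⟨hx, Or.inr (Filter.Eventually.of_forall fun y =>
        (hmax y).trans ((heq ▸ hmin x : k p ≤ k x)))⟩
    refine le_trans ?_ (encard_le_encard hall)
    rw [(Ico_infinite hc).encard_eq]
    exact le_top
  · refine HasFourLocalExtrema.neg (hγ.hasFourLocalExtrema_of_lt he hk.neg (fun x => by
      rw [hkp]) (Γ := fun x => -Γ x) (fun x => by simp only [hΓ x])
      (fun τ => (hΓd τ).neg.congr_deriv (by rw [neg_smul])) hq hp hlt
      (fun x => neg_le_neg (hmin x)) (fun x => neg_le_neg (hmax x)))

end FourVertex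

/-! ### The four vertex theorem -/

theorem theorem8p2 {X : Type*} [NormedAddCommGroup X] [NormedSpace ℝ X]
    (hX : Module.finrank ℝ X = 2)
    (ω : LinearMap.BilinForm ℝ X) (hω : ω.IsAlt) (hω0 : ω ≠ 0)
    (σ : ℝ → X) (l : ℝ) (hσ : IsStrictlyConvexCurve σ l) (hσS : range σ = sphere (0 : X) 1)
    (γ : ℝ → X) (c : ℝ) (hγ : IsStrictlyConvexCurve γ c) :
    ((∃ k, IsMinkowskiCurvature ω γ k) ∧
      ∀ k, IsMinkowskiCurvature ω γ k → HasFourLocalExtrema c k) ∧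
    ((∃ k, IsNormalCurvature ω γ k) ∧
      ∀ k, IsNormalCurvature ω γ k → HasFourLocalExtrema c k) ∧
    (((∀ t, ω (deriv σ t) (deriv (deriv σ) t) ≠ 0) → ∃ k, IsCircularCurvature ω γ k) ∧
      ∀ k, IsCircularCurvature ω γ k → HasFourLocalExtrema c k) ∧
    ((∃ k, IsArcLengthCurvature ω γ k) ∧
      ∀ k, IsArcLengthCurvature ω γ k → HasFourLocalExtrema c k) := by
  have hfd : FiniteDimensional ℝ X := Module.finite_of_finrank_eq_succ hX
  have hcs : CompleteSpace X := FiniteDimensional.complete ℝ X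
  obtain ⟨e, he⟩ := exists_isDetCoordinate hX hω hω0
  have hΦ : ContDiff ℝ 2 (polar e) := contDiff_polar he hσ.contDiff hσ.regular hσS
  obtain ⟨K, hKc, hK, hKσ⟩ := hσ.bounds
  have hsc : ∀ x y : X, ‖x‖ = 1 → ‖y‖ = 1 → ‖x + y‖ = 2 → x = y := fun x y =>
    eq_of_norm_add_eq_two hK hKc.isClosed (hKσ.trans hσS)
  have hγ' := hγ.toIsSimpleClosedCurve
  refine ⟨⟨exists_isMinkowskiCurvature he hΦ hγ', fun k hk => ?_⟩,
    ⟨exists_isNormalCurvature he hΦ hsc hγ', fun k hk => ?_⟩,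
    ⟨fun h => exists_isCircularCurvature he hΦ
      (form_deriv_polar_ne_zero he hΦ hσ.toIsSimpleClosedCurve hσS h) hγ', fun k hk => ?_⟩,
    ⟨exists_isArcLengthCurvature he hΦ hγ', fun k hk => ?_⟩⟩
  · refine hγ.hasFourLocalExtrema he ?_ (hk.exists_periodic_primitive he hΦ hγ')
    obtain ⟨_, _, _, _, h⟩ := hk
    exact h.continuous hγ'
  · refine hγ.hasFourLocalExtrema he ?_ (hk.exists_periodic_primitive he hΦ hγ')
    obtain ⟨_, _, _, _, _, _, h⟩ := hk
    exact h.continuous hγ'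
  · refine hγ.hasFourLocalExtrema he ?_ (hk.exists_periodic_primitive he hsc hγ')
    obtain ⟨_, _, _, _, h⟩ := hk
    exact h.continuous hγ'
  · refine hγ.hasFourLocalExtrema he ?_ (hk.exists_periodic_primitive he hΦ hγ')
    obtain ⟨_, _, _, _, h⟩ := hk
    exact h.continuous hγ'
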